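/- Let $\mathbb K$ be an algebraically closed field of characteristic $0$. Let $X\subset\mathbb A^n_{\mathbb K}$ be a smooth irreducible affine variety of dimension $N$ whose ideal $I$ is generated by $g_1,\dots,g_m$, let $\mathcal A=\mathbb K[x_1,\dots,x_n]/I$ and $\mathcal V=\mathrm{Der}(\mathcal A)$. The standard atlas of $X$ consists of the charts $N(h)=\{h\neq 0\}$, where $h$ runs over the non-zero $(n-N)\times(n-N)$ minors of the Jacobian matrix $(\partial g_j/\partial x_i)$. Chart parameters for $N(h)$ are algebraically independent $t_1,\dots,t_N\in\mathcal A$ such that $\mathcal A$ is algebraic over $\mathbb K[t_1,\dots,t_N]$ and each $\partial/\partial t_i$ extends to a derivation of the localization $\mathcal A_{(h)}$. An $\mathcal{AV}$-module is a vector space $M$ with actions of the commutative algebra $\mathcal A$ and the Lie algebra $\mathcal V$ satisfying $\eta(fm)=\eta(f)m+f(\eta m)$. Let $\mathcal L_+$ be the Lie algebra of derivations of $\mathbb K[t_1,\dots,t_N]$ of non-negative degree, and let $(U,\rho)$ be a finite-dimensional $\mathcal L_+$-module. Gauge fields are $\mathcal A_{(h)}$-linear operators $B_1,\dots,B_N$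 on $\mathcal A_{(h)}\otimes U$ commuting with $\rho(\mathcal L_+)$ and satisfying $[\partial/\partial t_i+B_i,\partial/\partial t_j+B_j]=0$. They define an action of $\mathcal V$ on $\mathcal A_{(h)}\otimes U$ by writing $\eta=\sum_i\eta(t_i)\,\partial/\partial t_i$ and $$\Big(f\tfrac{\partial}{\partial t_i}\Big)(g\otimes u)=f\tfrac{\partial g}{\partial t_i}\otimes u+fB_i(g\otimes u)+\sum_{k\in\mathbb Z_{\ge0}^N\setminus\{0\}}\frac1{k!}\,g\,\frac{\partial^kf}{\partial t^k}\otimes\rho\Big(t^k\tfrac{\partial}{\partial t_i}\Big)u .$$ An $\mathcal{AV}$-submodule of $\mathcal A_{(h)}\otimes U$ that is finitely generated over $\mathcal A$ is called a local gauge module; a gauge module is an $\mathcal{AV}$-module which, for each chart $N(h)$ of the standard atlas, is isomorphic to a local gauge module. A $\mathfrak{gl}_N$-module is regarded as an $\mathcal L_+$-module via $t_p\,\partial/\partial t_i\mapsto E_{pi}$, with all derivations of positive degree acting by $0$. Let $V=\mathbb K^N$ be the natural $\mathfrak{gl}_N$-module, with standard basis $e_1,\dots,e_N$. (1) Let $U$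 be a simple finite-dimensional $\mathfrak{gl}_N$-module that is not isomorphic to $\Lambda^kV$ for any $0\le k\le N$. Then every non-zero gauge module $M$ that is, in some chart $N(h)$ of the standard atlas, isomorphic to a local gauge module contained in $\mathcal A_{(h)}\otimes U$ is simple as a $\mathcal V$-module. (2) The exceptional modules do occur. Let $N\ge1$, $X=\mathbb A^N$, $h=1$, $t_i=x_i$, and for functions $b_1,\dots,b_N\in\mathcal A=\mathbb K[x_1,\dots,x_N]$ put $$d_k:\mathcal A\otimes\Lambda^kV\to\mathcal A\otimes\Lambda^{k+1}V,\qquad d_k(g\otimes v)=\sum_{p=1}^N\Big(\frac{\partial g}{\partial x_p}+b_pg\Big)\otimes e_p\wedge v .$$ For $0\le k<N$, the space $\mathcal A\otimes\Lambda^kV$ with gauge fields $b_i=0$ is a gauge module, and $\ker d_k$ is a proper non-zero $\mathcal V$-submodule of it. The space $\mathcal A\otimes\Lambda^NV$ with gauge fields given by multiplication by $b_i=-2x_i$ is a gauge module, and $\operatorname{im}d_{N-1}$ (with the same $b_i$) is a proper non-zero $\mathcal V$-submodule of it. In particular all these gauge modules are reducible over $\mathcal V$. -/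

import Mathlib

open scoped TensorProduct

attribute [local instance 100] LieRing.ofAssociativeRing

universe u v w

namespace Gauge

/-! ### Exterior powers of the natural `gl_N`-module -/

section Exterior

variable {K : Type u} [Field K] {V : Type v} [AddCommGroup V] [Module K V]

/-- Auxiliary algebra map `a ↦ (a, D a)` to the algebra `E ⊕ ε E`, where `D` is the derivation of
the exterior algebra `E` that extends `x`. -/
noncomputable def extLift (x : V →ₗ[K] V) :
    ExteriorAlgebra K V →ₐ[K] TrivSqZeroExt (ExteriorAlgebra K V) (ExteriorAlgebra K V) :=
  ExteriorAlgebra.lift K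
    ⟨{ toFun := fun v => TrivSqZeroExt.inl (ExteriorAlgebra.ι K v) +
          TrivSqZeroExt.inr (ExteriorAlgebra.ι K (x v))
       map_add' := fun a b => by
          ext <;> simp
       map_smul' := fun c a => by
          ext <;> simp },
      fun v => by
        ext
        · simp
        · simp [ExteriorAlgebra.ι_add_mul_swap]⟩

/-- The derivation of the exterior algebra of `V` that extends the endomorphism `x` of `V`:
`v₁ ∧ ⋯ ∧ v_k ↦ ∑_j v₁ ∧ ⋯ ∧ x v_j ∧ ⋯ ∧ v_k`. -/
noncomputable def extDer (x : V →ₗ[K] V) : Module.End K (ExteriorAlgebra K V) where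
  toFun a := (extLift x a).snd
  map_add' a b := by simp
  map_smul' c a := by simp

theorem extLift_fst (x : V →ₗ[K] V) (a : ExteriorAlgebra K V) : (extLift x a).fst = a := by
  induction a using ExteriorAlgebra.induction with
  | algebraMap r => simp [TrivSqZeroExt.algebraMap_eq_inl']
  | ι v => simp [extLift]
  | mul a b ha hb => simp [ha, hb]
  | add a b ha hb => simp [ha, hb]

theorem extDer_ι (x : V →ₗ[K] V) (v : V) :
    extDer x (ExteriorAlgebra.ι K v) = ExteriorAlgebra.ι K (x v) := by
  simp [extDer, extLift]

theorem extDer_algebraMap (x : V →ₗ[K] V) (r : K) :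
    extDer x (algebraMap K (ExteriorAlgebra K V) r) = 0 := by
  simp [extDer, TrivSqZeroExt.algebraMap_eq_inl']

theorem extDer_mul (x : V →ₗ[K] V) (a b : ExteriorAlgebra K V) :
    extDer x (a * b) = a * extDer x b + extDer x a * b := by
  simp [extDer, extLift_fst]

theorem extDer_add (x y : V →ₗ[K] V) (a : ExteriorAlgebra K V) :
    extDer (x + y) a = extDer x a + extDer y a := by
  induction a using ExteriorAlgebra.induction with
  | algebraMap r => simp [extDer_algebraMap]
  | ι v => simp [extDer_ι]
  | mul a b ha hb => simp only [extDer_mul, ha, hb]; noncomm_ring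
  | add a b ha hb => simp only [map_add, ha, hb]; abel

theorem extDer_smul (c : K) (x : V →ₗ[K] V) (a : ExteriorAlgebra K V) :
    extDer (c • x) a = c • extDer x a := by
  induction a using ExteriorAlgebra.induction with
  | algebraMap r => simp [extDer_algebraMap]
  | ι v => simp [extDer_ι]
  | mul a b ha hb => simp only [extDer_mul, ha, hb, smul_add, mul_smul_comm, smul_mul_assoc]
  | add a b ha hb => simp only [map_add, ha, hb, smul_add]

theorem extDer_lie (x y : Module.End K V) (a : ExteriorAlgebra K V) :
    extDer ⁅x, y⁆ a = extDer x (extDer y a) - extDer y (extDer x a) := by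
  induction a using ExteriorAlgebra.induction with
  | algebraMap r => simp [extDer_algebraMap]
  | ι v => simp [extDer_ι, Ring.lie_def]
  | mul a b ha hb => simp only [extDer_mul, map_add, ha, hb]; noncomm_ring
  | add a b ha hb => simp only [map_add, ha, hb]; abel

theorem extDer_mem (x : V →ₗ[K] V) {k : ℕ} {a : ExteriorAlgebra K V} (ha : a ∈ ⋀[K]^k V) :
    extDer x a ∈ ⋀[K]^k V := by
  induction ha using Submodule.pow_induction_on_left' with
  | algebraMap r => rw [extDer_algebraMap]; exact zero_mem _
  | add a b i ha hb iha ihb => rw [map_add]; exact add_mem iha ihb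
  | mem_mul m hm i a ha iha =>
    obtain ⟨v, rfl⟩ := hm
    rw [extDer_mul, extDer_ι, Nat.succ_eq_add_one, ExteriorAlgebra.exteriorPower, pow_succ']
    exact add_mem (Submodule.mul_mem_mul (LinearMap.mem_range_self _ v) iha)
      (Submodule.mul_mem_mul (LinearMap.mem_range_self _ (x v)) ha)

/-- `⋀^k K^N` as a module over `gl_N`, with
`x · (v₁ ∧ ⋯ ∧ v_k) = ∑_j v₁ ∧ ⋯ ∧ x v_j ∧ ⋯ ∧ v_k`. -/
noncomputable instance {N : ℕ} (k : ℕ) :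
    LieRingModule (Matrix (Fin N) (Fin N) K) (⋀[K]^k (Fin N → K)) where
  bracket x a := ⟨extDer (Matrix.toLin' x) a, extDer_mem _ a.2⟩
  add_lie x y a := by ext; simp [extDer_add]
  lie_add x a b := by ext; simp
  leibniz_lie x y a := by
    ext
    have h : Matrix.toLin' ⁅x, y⁆ = ⁅(Matrix.toLin' x : Module.End K (Fin N → K)),
        (Matrix.toLin' y : Module.End K (Fin N → K))⁆ := by
      simp [Ring.lie_def, Matrix.toLin'_mul, Module.End.mul_eq_comp]
    simp [h, extDer_lie]

instance {N : ℕ} (k : ℕ) :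
    LieModule K (Matrix (Fin N) (Fin N) K) (⋀[K]^k (Fin N → K)) where
  smul_lie c x a := by
    ext
    change extDer (Matrix.toLin' (c • x)) (a : ExteriorAlgebra K (Fin N → K)) = _
    rw [map_smul, extDer_smul]
    rfl
  lie_smul c x a := by
    ext
    exact map_smul (extDer (Matrix.toLin' x)) c (a : ExteriorAlgebra K (Fin N → K))

/-- Left exterior multiplication `a ↦ v ∧ a`, from `⋀^k V` to `⋀^(k+1) V`. -/
noncomputable def wedge (v : V) (k : ℕ) : ⋀[K]^k V →ₗ[K] ⋀[K]^(k + 1) V :=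
  (LinearMap.mulLeft K (ExteriorAlgebra.ι K v)).restrict fun a ha => by
    rw [ExteriorAlgebra.exteriorPower, pow_succ']
    exact Submodule.mul_mem_mul (LinearMap.mem_range_self _ v) ha

end Exterior

/-! ### The Lie algebra `L₊` of polynomial vector fields vanishing at the origin -/

section LPlus

variable (K : Type u) [Field K] (N : ℕ)

theorem derivation_sum_apply {K : Type u} [Field K] {N : ℕ}
    (D : Fin N → Derivation K (MvPolynomial (Fin N) K) (MvPolynomial (Fin N) K))
    (f : MvPolynomial (Fin N) K) : (∑ q, D q) f = ∑ q, D q f := by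
  have h := map_sum (Derivation.coeFnAddMonoidHom (R := K) (A := MvPolynomial (Fin N) K)
    (M := MvPolynomial (Fin N) K)) D Finset.univ
  exact (congrFun h f).trans (Finset.sum_apply _ _ _)

theorem derivation_eq_sum {K : Type u} [Field K] {N : ℕ}
    (D : Derivation K (MvPolynomial (Fin N) K) (MvPolynomial (Fin N) K))
    (f : MvPolynomial (Fin N) K) :
    D f = ∑ q, MvPolynomial.pderiv q f * D (MvPolynomial.X q) := by
  have h : D = ∑ q, D (MvPolynomial.X q) • MvPolynomial.pderiv q := by
    apply MvPolynomial.derivation_ext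
    intro i
    simp [derivation_sum_apply, MvPolynomial.pderiv_X, Pi.single_apply]
  conv_lhs => rw [h]
  simp [derivation_sum_apply, mul_comm]

/-- `L₊`: the derivations of `K[t₁, …, t_N]` of non-negative degree, that is `∑ f_i ∂/∂t_i` where
no `f_i` has a constant term. -/
noncomputable def LPlus :
    LieSubalgebra K (Derivation K (MvPolynomial (Fin N) K) (MvPolynomial (Fin N) K)) where
  carrier := {D | ∀ i, MvPolynomial.constantCoeff (D (MvPolynomial.X i)) = 0}
  add_mem' := by
    intro a b ha hb i
    simp [ha i, hb i]
  zero_mem' := by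
    intro i
    simp
  smul_mem' := by
    intro c D hD i
    rw [Derivation.smul_apply, MvPolynomial.constantCoeff_smul, hD i, smul_zero]
  lie_mem' := by
    intro D E hD hE i
    rw [Derivation.commutator_apply, derivation_eq_sum D, derivation_eq_sum E (D _)]
    simp [hD _, hE _]

variable {K N}

/-- The element `t^k ∂/∂t_i` of `L₊`, for a non-zero exponent `k`. -/
noncomputable def LPlus.mono (k : {k : Fin N →₀ ℕ // k ≠ 0}) (i : Fin N) : LPlus K N :=
  ⟨MvPolynomial.monomial k.1 (1 : K) • MvPolynomial.pderiv i, fun j => by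
    have h : MvPolynomial.constantCoeff (MvPolynomial.monomial k.1 (1 : K)) = 0 := by
      rw [MvPolynomial.constantCoeff_monomial, if_neg k.2]
    simp [h]⟩

variable (K N)

/-- The projection `L₊ → L₀ ≅ gl_N`, which takes the linear part of a vector field at the origin:
`t_p ∂/∂t_i ↦ E_{pi}`, and all vector fields of positive degree go to `0`. -/
noncomputable def linearPart : LPlus K N →ₗ⁅K⁆ Matrix (Fin N) (Fin N) K where
  toFun D := Matrix.of fun p i =>
    MvPolynomial.constantCoeff (MvPolynomial.pderiv p (D.1 (MvPolynomial.X i)))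
  map_add' D E := by
    ext p i
    simp
  map_smul' c D := by
    ext p i
    simp
  map_lie' := by
    rintro ⟨D, hD⟩ ⟨E, hE⟩
    have key : ∀ D E : Derivation K (MvPolynomial (Fin N) K) (MvPolynomial (Fin N) K),
        (∀ i, MvPolynomial.constantCoeff (D (MvPolynomial.X i)) = 0) → ∀ p i,
        MvPolynomial.constantCoeff (MvPolynomial.pderiv p (D (E (MvPolynomial.X i)))) =
          ∑ q, MvPolynomial.constantCoeff (MvPolynomial.pderiv p (D (MvPolynomial.X q))) *
            MvPolynomial.constantCoeff (MvPolynomial.pderiv q (E (MvPolynomial.X i))) := by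
      intro D E hD p i
      rw [derivation_eq_sum D (E _)]
      simp [hD, mul_comm]
    ext p i
    simp only [Matrix.of_apply, Ring.lie_def, Matrix.sub_apply, Matrix.mul_apply]
    rw [← key D E hD, ← key E D hE]
    simp [Derivation.commutator_apply]

/-- A `gl_N`-module `U`, viewed as an `L₊`-module on which all vector fields of positive degree
act by zero. -/
noncomputable def inflate (U : Type v) [AddCommGroup U] [Module K U]
    [LieRingModule (Matrix (Fin N) (Fin N) K) U] [LieModule K (Matrix (Fin N) (Fin N) K) U] :
    LPlus K N →ₗ⁅K⁆ Module.End K U :=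
  (LieModule.toEnd K (Matrix (Fin N) (Fin N) K) U).comp (linearPart K N)

end LPlus

/-! ### Chart parameters, gauge fields and local gauge modules -/

section Local

variable {K : Type u} [Field K] {A : Type v} [CommRing A] [Algebra K A]

/-- Chart parameters `t₁, …, t_N` in the chart where `h ≠ 0`, together with the extensions
`der i` of the derivations `∂/∂t_i` to the localized algebra `A_(h)` (which are unique). -/
structure ChartParameters (K : Type u) [Field K] {A : Type v} [CommRing A] [Algebra K A]
    (h : A) (N : ℕ) where
  /-- the parameters -/
  t : Fin N → A
  algebraicIndependent : AlgebraicIndependent K t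
  isAlgebraic : Algebra.IsAlgebraic (Algebra.adjoin K (Set.range t)) A
  /-- the derivations `∂/∂t_i` of `A_(h)` -/
  der : Fin N → Derivation K (Localization.Away h) (Localization.Away h)
  der_t : ∀ i j, der i (algebraMap A (Localization.Away h) (t j)) = if i = j then 1 else 0

variable {h : A} {N : ℕ} (c : ChartParameters K h N)
  {U : Type w} [AddCommGroup U] [Module K U]

/-- `∂^k f / ∂t^k` for a multi-index `k`. -/
noncomputable def ChartParameters.iterDer (k : Fin N →₀ ℕ) (f : Localization.Away h) :
    Localization.Away h :=
  (List.ofFn fun i : Fin N =>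
    ((c.der i : Module.End K (Localization.Away h)) ^ k i)).prod f

/-- The operator `∂/∂t_i` on `A_(h) ⊗ U`. -/
noncomputable def ChartParameters.derTensor (U : Type w) [AddCommGroup U] [Module K U]
    (i : Fin N) : Module.End K (Localization.Away h ⊗[K] U) :=
  LinearMap.rTensor U (c.der i : Module.End K (Localization.Away h))

/-- Gauge fields: `A_(h)`-linear operators `B_i` on `A_(h) ⊗ U` that commute with `ρ(L₊)` and
satisfy `[∂/∂t_i + B_i, ∂/∂t_j + B_j] = 0`. -/
structure IsGaugeField (ρ : LPlus K N →ₗ⁅K⁆ Module.End K U)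
    (B : Fin N → Module.End (Localization.Away h) (Localization.Away h ⊗[K] U)) : Prop where
  commute_rho : ∀ (i : Fin N) (x : LPlus K N) (m : Localization.Away h ⊗[K] U),
    B i (LinearMap.lTensor (Localization.Away h) (ρ x) m) =
      LinearMap.lTensor (Localization.Away h) (ρ x) (B i m)
  flat : ∀ i j : Fin N,
    ⁅c.derTensor U i + (B i).restrictScalars K, c.derTensor U j + (B j).restrictScalars K⁆ = 0

/-- The action on `A_(h) ⊗ U` of a vector field `η = ∑ f_i ∂/∂t_i`, where `f_i = η(t_i)`:
`(f ∂/∂t_i) (g ⊗ u) = f ∂g/∂t_i ⊗ u + f B_i (g ⊗ u)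
  + ∑_{k ≠ 0} (1/k!) g (∂^k f/∂t^k) ⊗ ρ(t^k ∂/∂t_i) u`.
For finite-dimensional `U` only finitely many terms of the sum over `k` are non-zero. -/
noncomputable def gaugeAction (ρ : LPlus K N →ₗ⁅K⁆ Module.End K U)
    (B : Fin N → Module.End (Localization.Away h) (Localization.Away h ⊗[K] U))
    (η : Derivation K A A) : Module.End K (Localization.Away h ⊗[K] U) :=
  ∑ i : Fin N,
    (LinearMap.lsmul (Localization.Away h) (Localization.Away h ⊗[K] U)
        (algebraMap A (Localization.Away h) (η (c.t i)))).restrictScalars K *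
      (c.derTensor U i + (B i).restrictScalars K) +
  ∑ i : Fin N, ∑ᶠ k : {k : Fin N →₀ ℕ // k ≠ 0},
    ((∏ p, ((k.1 p).factorial : K))⁻¹) •
      TensorProduct.map
        (LinearMap.mulLeft K
          (c.iterDer k.1 (algebraMap A (Localization.Away h) (η (c.t i)))))
        (ρ (LPlus.mono k i))

/-- Compatibility of the actions of `A` and of `Der A` on an `AV`-module:
`η (f m) = η(f) m + f (η m)`. -/
def IsAVModule (K : Type u) [Field K] (A : Type v) [CommRing A] [Algebra K A]
    (M : Type w) [AddCommGroup M] [Module A M] [LieRingModule (Derivation K A A) M] : Prop :=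
  ∀ (η : Derivation K A A) (f : A) (m : M), ⁅η, f • m⁆ = η f • m + f • ⁅η, m⁆

/-- An `AV`-module `M` of finite rank over `A` is (isomorphic to) the local gauge module given by
an `AV`-submodule of `A_(h) ⊗ U` with gauge fields `B`. -/
def IsLocalGaugeModule (ρ : LPlus K N →ₗ⁅K⁆ Module.End K U)
    (B : Fin N → Module.End (Localization.Away h) (Localization.Away h ⊗[K] U))
    (M : Type*) [AddCommGroup M] [Module A M] [LieRingModule (Derivation K A A) M] : Prop :=
  Module.Finite A M ∧
    ∃ ι : M →ₗ[A] Localization.Away h ⊗[K] U, Function.Injective ι ∧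
      ∀ (η : Derivation K A A) (m : M), ι ⁅η, m⁆ = gaugeAction c ρ B η (ι m)

/-- Gauge fields given by functions `b_i ∈ A_(h)`, acting on `A_(h) ⊗ U` by multiplication. -/
noncomputable def scalarField (K : Type u) [Field K] {A : Type v} [CommRing A] [Algebra K A]
    {h : A} {N : ℕ} (U : Type w) [AddCommGroup U] [Module K U] (b : Fin N → Localization.Away h)
    (i : Fin N) : Module.End (Localization.Away h) (Localization.Away h ⊗[K] U) :=
  LinearMap.lsmul (Localization.Away h) (Localization.Away h ⊗[K] U) (b i)

/-- The twisted de Rham differential `A_(h) ⊗ ⋀^k V → A_(h) ⊗ ⋀^(k+1) V`, `V = K^N`: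
`d_k (g ⊗ v) = ∑_p (∂g/∂t_p + b_p g) ⊗ (e_p ∧ v)`. -/
noncomputable def deRham (b : Fin N → Localization.Away h) (k : ℕ) :
    Localization.Away h ⊗[K] ⋀[K]^k (Fin N → K) →ₗ[K]
      Localization.Away h ⊗[K] ⋀[K]^(k + 1) (Fin N → K) :=
  ∑ p : Fin N, TensorProduct.map
    ((c.der p : Module.End K (Localization.Away h)) + LinearMap.mulLeft K (b p))
    (wedge (Pi.single p (1 : K)) k)

end Local

/-! ### Affine varieties and gauge modules -/

section Variety

variable {K : Type u} [Field K] {n m : ℕ}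

/-- The algebra `K[x₁, …, x_n] / ⟨g₁, …, g_m⟩`. -/
abbrev CoordRing (g : Fin m → MvPolynomial (Fin n) K) : Type u :=
  MvPolynomial (Fin n) K ⧸ Ideal.span (Set.range g)

/-- The polynomials `g₁, …, g_m` generate the ideal of a smooth irreducible affine variety of
dimension `N` in affine `n`-space: the ideal is prime, and at every point of the zero locus
the Jacobian matrix has rank `n - N`. -/
structure IsSmoothIrreducible (g : Fin m → MvPolynomial (Fin n) K) (N : ℕ) : Prop where
  isPrime : (Ideal.span (Set.range g)).IsPrime
  dim : ringKrullDim (CoordRing g) = N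
  rank_jacobian : ∀ p : Fin n → K, (∀ j, MvPolynomial.eval p (g j) = 0) →
    (Matrix.of fun (j : Fin m) (i : Fin n) =>
      MvPolynomial.eval p (MvPolynomial.pderiv i (g j))).rank + N = n

/-- The minor of the Jacobian matrix with the given rows and columns, as an element of the
coordinate ring. -/
noncomputable def jacobianMinor (g : Fin m → MvPolynomial (Fin n) K) {r : ℕ}
    (rows : Fin r → Fin m) (cols : Fin r → Fin n) : CoordRing g :=
  (Matrix.of fun a b : Fin r =>
    Ideal.Quotient.mk (Ideal.span (Set.range g))
      (MvPolynomial.pderiv (cols b) (g (rows a)))).det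

/-- Gauge modules on the variety of dimension `N` given by `g`: `AV`-modules that, in each chart of
the standard atlas (one chart for each non-zero minor of size `n - N` of the Jacobian matrix), are
isomorphic to a local gauge module built from some finite-dimensional `L₊`-module. -/
def IsGaugeModule (g : Fin m → MvPolynomial (Fin n) K) (N : ℕ)
    (M : Type*) [AddCommGroup M] [Module (CoordRing g) M]
    [LieRingModule (Derivation K (CoordRing g) (CoordRing g)) M] : Prop :=
  IsAVModule K (CoordRing g) M ∧
  ∀ (r : ℕ) (rows : Fin r → Fin m) (cols : Fin r → Fin n), r + N = n →
    jacobianMinor g rows cols ≠ 0 →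
    ∃ (c : ChartParameters K (jacobianMinor g rows cols) N)
      (d : ℕ) (ρ : LPlus K N →ₗ⁅K⁆ Module.End K (Fin d → K))
      (B : Fin N → Module.End (Localization.Away (jacobianMinor g rows cols))
        (Localization.Away (jacobianMinor g rows cols) ⊗[K] (Fin d → K))),
      IsGaugeField c ρ B ∧ IsLocalGaugeModule c ρ B M

/-- The (empty) system of equations of affine `N`-space. -/
def affineSpace (K : Type u) [Field K] (N : ℕ) : Fin 0 → MvPolynomial (Fin N) K :=
  Fin.elim0

/-- On `X = 𝔸^N` (with `h = 1` and chart parameters `c`), the space `A_(h) ⊗ ⋀^k K^N` with gauge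
fields the multiplications by the functions `b_i` is a gauge module, and `W` is a proper non-zero
submodule of it over the Lie algebra of vector fields; in particular it is reducible. -/
def IsReducibleGaugeModule {N : ℕ}
    (c : ChartParameters K (1 : CoordRing (affineSpace K N)) N)
    (b : Fin N → Localization.Away (1 : CoordRing (affineSpace K N))) (k : ℕ)
    (W : Submodule K
      (Localization.Away (1 : CoordRing (affineSpace K N)) ⊗[K] ⋀[K]^k (Fin N → K))) : Prop :=
  IsGaugeField c (inflate K N (⋀[K]^k (Fin N → K))) (scalarField K _ b) ∧
  ∃ (_ : LieRingModule
        (Derivation K (CoordRing (affineSpace K N)) (CoordRing (affineSpace K N)))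
        (Localization.Away (1 : CoordRing (affineSpace K N)) ⊗[K] ⋀[K]^k (Fin N → K)))
    (_ : LieModule K
        (Derivation K (CoordRing (affineSpace K N)) (CoordRing (affineSpace K N)))
        (Localization.Away (1 : CoordRing (affineSpace K N)) ⊗[K] ⋀[K]^k (Fin N → K))),
    (∀ (η : Derivation K (CoordRing (affineSpace K N)) (CoordRing (affineSpace K N)))
      (w : Localization.Away (1 : CoordRing (affineSpace K N)) ⊗[K] ⋀[K]^k (Fin N → K)),
      ⁅η, w⁆ =
        gaugeAction c (inflate K N (⋀[K]^k (Fin N → K))) (scalarField K _ b) η w) ∧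
    IsGaugeModule (affineSpace K N) N
      (Localization.Away (1 : CoordRing (affineSpace K N)) ⊗[K] ⋀[K]^k (Fin N → K)) ∧
    ¬ LieModule.IsIrreducible K
      (Derivation K (CoordRing (affineSpace K N)) (CoordRing (affineSpace K N)))
      (Localization.Away (1 : CoordRing (affineSpace K N)) ⊗[K] ⋀[K]^k (Fin N → K)) ∧
    ∃ S : LieSubmodule K
        (Derivation K (CoordRing (affineSpace K N)) (CoordRing (affineSpace K N)))
        (Localization.Away (1 : CoordRing (affineSpace K N)) ⊗[K] ⋀[K]^k (Fin N → K)),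
      S.toSubmodule = W ∧ S ≠ ⊥ ∧ S ≠ ⊤

end Variety

end Gauge

/-!
Throughout, `X_{f,i}` denotes the action of `f ∂/∂t_i` on `A_(h) ⊗ U` (`fieldOp`). When `L₊` acts
through `gl_N`, only the terms with `|k| = 1` of the defining sum survive, so
`X_{f,i} = f D_i + ∑_p ∂f/∂t_p ⊗ E_{pi}` with the covariant derivative `D_i = ∂/∂t_i + B_i`
(`gaugeAction_inflate`). Up to a fixed power of `h`, all these fields come from derivations of `A`
(`ChartParameters.exists_lift`).

*Simplicity.* A gauge module `M` over a simple `U` has no proper non-zero `AV`-submodules: the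
`A_(h)`-span of one is stable under `D_i` and, because `X_{t_p f,i} - t_p X_{f,i} = f ⊗ E_{pi}`,
under `E_{pi}`, hence under all of `End U` by Burnside's theorem. So the ideal `J` of all `f` for
which `f ⊗ U` is in the span is non-zero, and it is stable under the `∂/∂t_i`. It meets the
polynomial ring `K[t]`, over which `A` is algebraic, and a non-zero polynomial of minimal degree in
`J` is a constant, so `J` is the unit ideal (`ChartParameters.eq_top_of_der_mem`). Hence the
annihilator of the quotient of `M` by the submodule contains a power of `h`. This annihilator is an
ideal stable under derivations, so it is the unit ideal in every chart, and the charts cover the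
variety by the Jacobian criterion and the Nullstellensatz (`IsSmoothIrreducible.eq_top`).

For a submodule `W` over the vector fields alone, the second difference
`X_{abf,i} X_{g,j} - X_{af,i} X_{bg,j} - X_{bf,i} X_{ag,j} + X_{f,i} X_{abg,j}` has order zero
(`quadratic_identity`), and for `a = t_s`, `b = t_r` it is `f g` times a fixed quadratic expression
in the matrix units. Either such an expression takes an element of `W` to a non-zero element, all of
whose `A`-multiples are then in `W`, and the case of `AV`-submodules applies; or `U` has a non-zero
vector killed by all of these expressions, and then they vanish on the simple module `U`. They are
the relations between the operators `e_a ∧ ι_b` on the exterior algebra: the weights of `U` are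
indicator functions of subsets, a weight that is an initial segment of size `k` occurs, and
comparing highest weight vectors identifies `U` with `⋀^k V` (`exists_equiv_of_isWeightVector`,
`exists_equiv_exteriorPower`).

*The exceptional modules.* The twisted de Rham differential commutes with vector fields
(`deRham_gaugeAction`), since the Hessian of a function is symmetric while `e_p ∧ E_{qi}` is
antisymmetric in `p` and `q`. So kernels and images are submodules. On affine space, a constant form
is in the kernel of the untwisted differential and `x_p ⊗ v` with `e_p ∧ v ≠ 0` is not. For
`b_i = -2 x_i` and top forms, the image is non-zero, and it is proper because integration
against the density `exp (-∑ x_i^2)`, defined on polynomials by its moments, vanishes on the image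
and not on the constants (`gaussIntegral_pderiv`).
-/

namespace Gauge

/-! ### Fermionic representations of `gl_N` -/

section Fermionic

variable {K : Type u} [Field K] {N : ℕ} {Y : Type v} [AddCommGroup Y] [Module K Y]

/-- Operators `E a b` satisfying the commutation relations of the matrix units of `gl_N` together
with the quadratic relations of the number-preserving operators `e_a ∧ ι_b` on the exterior
algebra. -/
structure IsFermionic (E : Fin N → Fin N → Module.End K Y) : Prop where
  comm : ∀ a b c d y, E a b (E c d y) - E c d (E a b y) =
    (if b = c then E a d y else 0) - (if d = a then E c b y else 0)
  quad : ∀ s i r j y, E s i (E r j y) + E r i (E s j y) =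
    (if i = s then E r j y else 0) + (if i = r then E s j y else 0)

/-- `y` is a (possibly zero) weight vector whose weight is the indicator function of `S`. -/
def IsWeightVector (E : Fin N → Fin N → Module.End K Y) (S : Finset (Fin N)) (y : Y) : Prop :=
  ∀ a, E a a y = if a ∈ S then y else 0

/-- `Z` is stable under all operators `E a b`. -/
def IsStable (E : Fin N → Fin N → Module.End K Y) (Z : Submodule K Y) : Prop :=
  ∀ a b, ∀ y ∈ Z, E a b y ∈ Z

variable (K) in
theorem eq_of_add_self_eq [CharZero K] {y z : Y} (h : y + y = z + z) : y = z := by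
  have : (2 : K) • y = (2 : K) • z := by rw [two_smul, two_smul, h]
  exact smul_right_injective Y (two_ne_zero : (2 : K) ≠ 0) this

theorem exists_sum_lt_of_not_isLowerSet {S : Finset (Fin N)}
    (hS : ¬ IsLowerSet (S : Set (Fin N))) :
    ∃ a b : Fin N, a < b ∧ b ∈ S ∧ a ∉ S ∧
      ∑ i ∈ insert a (S.erase b), (i : ℕ) < ∑ i ∈ S, (i : ℕ) := by
  simp only [IsLowerSet, not_forall, Finset.mem_coe] at hS
  obtain ⟨b, a, hab, hb, ha⟩ := hS
  have hlt : a < b := lt_of_le_of_ne hab fun h => ha (h ▸ hb)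
  refine ⟨a, b, hlt, hb, ha, ?_⟩
  rw [Finset.sum_insert (fun h => ha (Finset.mem_of_mem_erase h)),
    ← Finset.add_sum_erase S (fun i => (i : ℕ)) hb]
  exact Nat.add_lt_add_right hlt _

namespace IsFermionic

variable {E : Fin N → Fin N → Module.End K Y}

variable (hE : IsFermionic E)
include hE

theorem apply_apply {S : Finset (Fin N)} {y : Y} (hy : IsWeightVector E S y) {a b : Fin N}
    (hab : a ≠ b) (hb : b ∈ S) (ha : a ∉ S) : E b a (E a b y) = y := by
  have h := hE.quad b a a b y
  simpa [hab, hy b, hb, hy a, ha] using h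

variable [CharZero K]

theorem diag_left (a b : Fin N) (y : Y) : E a a (E a b y) = E a b y := by
  apply eq_of_add_self_eq K
  simpa using hE.quad a a a b y

theorem apply_diag_right {a b : Fin N} (hab : a ≠ b) (y : Y) : E a b (E b b y) = E a b y := by
  have h1 := hE.quad a b b b y
  have h2 := hE.comm a b b b y
  simp only [hab.symm, if_true, if_false, zero_add, sub_zero] at h1 h2
  apply eq_of_add_self_eq K
  rw [← sub_eq_zero] at h1 h2 ⊢
  have := congrArg₂ (· + ·) h1 h2
  simp only [add_zero] at this
  rw [← this]
  abel

theorem diag_right_apply {a b : Fin N} (hab : a ≠ b) (y : Y) : E b b (E a b y) = 0 := by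
  have h2 := hE.comm a b b b y
  rw [hE.apply_diag_right hab] at h2
  simpa [hab.symm] using h2

theorem apply_diag_left {a b : Fin N} (hab : a ≠ b) (y : Y) : E a b (E a a y) = 0 := by
  have h1 := hE.quad a b a a y
  simp only [hab.symm, if_false, add_zero] at h1
  exact eq_of_add_self_eq K (h1.trans (add_zero 0).symm)

theorem apply_eq_zero {S : Finset (Fin N)} {y : Y} (hy : IsWeightVector E S y) {a b : Fin N}
    (hab : a ≠ b) (h : b ∉ S ∨ a ∈ S) : E a b y = 0 := by
  rcases h with h | h
  · rw [← hE.apply_diag_right hab, hy b, if_neg h, map_zero]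
  · have := hE.apply_diag_left hab y
    rwa [hy a, if_pos h] at this

/-- `E a b` moves a weight from `b` to `a`. -/
theorem isWeightVector_apply {S : Finset (Fin N)} {y : Y} (hy : IsWeightVector E S y)
    {a b : Fin N} (hab : a ≠ b) : IsWeightVector E (insert a (S.erase b)) (E a b y) := by
  intro c
  rcases eq_or_ne c a with rfl | hca
  · simp [hE.diag_left]
  rcases eq_or_ne c b with rfl | hcb
  · simp [hE.diag_right_apply hab, hca]
  have h := hE.comm c c a b y
  rw [if_neg hca, if_neg hcb.symm, sub_zero, sub_eq_zero] at h
  rw [h, hy c]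
  by_cases hc : c ∈ S <;> simp [hc, hca, hcb]

/-- The diagonal operators are commuting idempotents, so a non-zero stable subspace contains a
weight vector. -/
theorem exists_isWeightVector {Z : Submodule K Y} (hZ : IsStable E Z) (hne : Z ≠ ⊥) :
    ∃ S : Finset (Fin N), ∃ y ∈ Z, y ≠ 0 ∧ IsWeightVector E S y := by
  classical
  have key : ∀ s : Finset (Fin N), ∃ y ∈ Z, y ≠ 0 ∧ ∀ a ∈ s, E a a y = 0 ∨ E a a y = y := by
    intro s
    induction s using Finset.induction_on with
    | empty =>
      obtain ⟨y, hy, hy0⟩ := Z.ne_bot_iff.mp hne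
      exact ⟨y, hy, hy0, by simp⟩
    | insert b s _ ih =>
      obtain ⟨y, hy, hy0, h⟩ := ih
      by_cases hb : E b b y = 0
      · refine ⟨y, hy, hy0, fun a ha => ?_⟩
        rcases Finset.mem_insert.mp ha with rfl | ha
        exacts [Or.inl hb, h a ha]
      · refine ⟨E b b y, hZ b b y hy, hb, fun a ha => ?_⟩
        rcases Finset.mem_insert.mp ha with rfl | ha
        · exact Or.inr (hE.diag_left a a y)
        · have hc : E a a (E b b y) = E b b (E a a y) := by
            rw [← sub_eq_zero, hE.comm]
            rcases eq_or_ne a b with rfl | hab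
            · simp
            · simp [hab, hab.symm]
          rw [hc]
          rcases h a ha with h | h <;> simp [h]
  obtain ⟨y, hy, hy0, h⟩ := key Finset.univ
  refine ⟨Finset.univ.filter fun a => E a a y = y, y, hy, hy0, fun a => ?_⟩
  rcases h a (Finset.mem_univ a) with h | h
  · by_cases h' : E a a y = y
    · simp [h']
    · simp [h, hy0.symm]
  · simp [h]

/-- A weight vector for which the sum of the elements of the weight is minimal is a highest
weight vector: its weight is an initial segment. -/
theorem exists_isWeightVector_isLowerSet {Z : Submodule K Y} (hZ : IsStable E Z) (hne : Z ≠ ⊥) :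
    ∃ S : Finset (Fin N), IsLowerSet (S : Set (Fin N)) ∧
      ∃ y ∈ Z, y ≠ 0 ∧ IsWeightVector E S y := by
  obtain ⟨S₀, hS₀⟩ := hE.exists_isWeightVector hZ hne
  have key : ∀ n : ℕ, ∀ S : Finset (Fin N), ∑ i ∈ S, (i : ℕ) = n →
      (∃ y ∈ Z, y ≠ 0 ∧ IsWeightVector E S y) →
      ∃ S : Finset (Fin N), IsLowerSet (S : Set (Fin N)) ∧
        ∃ y ∈ Z, y ≠ 0 ∧ IsWeightVector E S y := by
    intro n
    induction n using Nat.strong_induction_on with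
    | _ n ih =>
      rintro S rfl ⟨y, hy, hy0, hw⟩
      by_cases hS : IsLowerSet (S : Set (Fin N))
      · exact ⟨S, hS, y, hy, hy0, hw⟩
      obtain ⟨a, b, hab, hb, ha, hlt⟩ := exists_sum_lt_of_not_isLowerSet hS
      refine ih _ hlt _ rfl ⟨E a b y, hZ a b y hy, fun h => hy0 ?_,
        hE.isWeightVector_apply hw hab.ne⟩
      rw [← hE.apply_apply hw hab.ne hb ha, h, map_zero]
  exact key _ S₀ rfl hS₀

end IsFermionic

theorem eq_of_isLowerSet {S T : Finset (Fin N)} (hS : IsLowerSet (S : Set (Fin N)))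
    (hT : IsLowerSet (T : Set (Fin N))) (h : S.card = T.card) : S = T := by
  rcases hS.total hT with h' | h'
  · exact Finset.eq_of_subset_of_card_le (by exact_mod_cast h') h.ge
  · exact (Finset.eq_of_subset_of_card_le (by exact_mod_cast h') h.le).symm

section WeightBasis

variable {E : Fin N → Fin N → Module.End K Y} {k : ℕ}
  (b : Module.Basis (Set.powersetCard (Fin N) k) K Y)
  (hb : ∀ R : Set.powersetCard (Fin N) k, IsWeightVector E (R : Finset (Fin N)) (b R))
include hb

theorem eq_smul_of_isWeightVector {S : Finset (Fin N)} {y : Y} (hy : IsWeightVector E S y)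
    (hy0 : y ≠ 0) : ∃ hS : S.card = k, y = b.repr y ⟨S, hS⟩ • b ⟨S, hS⟩ := by
  have hrepr : ∀ (a : Fin N) (R : Set.powersetCard (Fin N) k) (z : Y),
      b.repr (E a a z) R = if a ∈ (R : Finset (Fin N)) then b.repr z R else 0 := by
    intro a R z
    induction b.mem_span z using Submodule.span_induction with
    | mem _ hz =>
      obtain ⟨T, rfl⟩ := hz
      rw [hb T a]
      rcases eq_or_ne T R with rfl | hTR
      · split_ifs <;> simp
      · split_ifs <;> simp [hTR]
    | zero => simp
    | add y z _ _ hy hz => simp only [map_add, Finsupp.add_apply, hy, hz]; split_ifs <;> simp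
    | smul c y _ hy => simp only [map_smul, Finsupp.smul_apply, hy]; split_ifs <;> simp
  have hR : ∀ R : Set.powersetCard (Fin N) k, b.repr y R ≠ 0 → (R : Finset (Fin N)) = S := by
    intro R hR
    ext a
    have h := hrepr a R y
    rw [hy a] at h
    by_cases h1 : a ∈ S <;> by_cases h2 : a ∈ (R : Finset (Fin N)) <;> simp_all
  obtain ⟨R, hR0⟩ : ∃ R, b.repr y R ≠ 0 := by
    by_contra! h
    exact hy0 (b.repr.map_eq_zero_iff.mp (Finsupp.ext h))
  have hRS := hR R hR0
  subst hRS
  refine ⟨R.2, b.repr.injective (Finsupp.ext fun T => ?_)⟩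
  rcases eq_or_ne T R with rfl | hTR
  · simp
  · have : b.repr y T = 0 := by
      by_contra h
      exact hTR (Subtype.ext (hR T h))
    rw [this]
    simp [hTR.symm]

variable [CharZero K]

theorem eq_top_of_mem_isLowerSet (hE : IsFermionic E) {S : Set.powersetCard (Fin N) k}
    (hS : IsLowerSet ((S : Finset (Fin N)) : Set (Fin N))) {W : Submodule K Y}
    (hW : IsStable E W) (hSW : b S ∈ W) : W = ⊤ := by
  have key : ∀ n : ℕ, ∀ R : Set.powersetCard (Fin N) k,
      ∑ i ∈ (R : Finset (Fin N)), (i : ℕ) = n → b R ∈ W := by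
    intro n
    induction n using Nat.strong_induction_on with
    | _ n ih =>
      rintro R rfl
      by_cases hR : IsLowerSet ((R : Finset (Fin N)) : Set (Fin N))
      · have : R = S := Subtype.ext (eq_of_isLowerSet hR hS (R.2.trans S.2.symm))
        rwa [this]
      obtain ⟨a, c, hac, hc, ha, hlt⟩ := exists_sum_lt_of_not_isLowerSet hR
      have h1 := hE.apply_apply (hb R) hac.ne hc ha
      have hne : E a c (b R) ≠ 0 := fun h => b.ne_zero R (by rw [← h1, h, map_zero])
      obtain ⟨hcard, heq⟩ := eq_smul_of_isWeightVector b hb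
        (hE.isWeightVector_apply (hb R) hac.ne) hne
      rw [← h1, heq]
      exact hW _ _ _ (W.smul_mem _ (ih _ hlt ⟨_, hcard⟩ rfl))
  rw [eq_top_iff, ← b.span_eq, Submodule.span_le]
  rintro _ ⟨R, rfl⟩
  exact key _ R rfl

end WeightBasis

section Cyclic

/-- For a highest weight vector `x`, the subspace generated by `x` under the lowering operators is
stable under all of `gl_N`, and its elements of the same weight as `x` are the multiples of `x`. -/
theorem exists_cyclic {E : Fin N → Fin N → Module.End K Y} [CharZero K]
    (comm : ∀ a b c d y, E a b (E c d y) - E c d (E a b y) =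
      (if b = c then E a d y else 0) - (if d = a then E c b y else 0))
    {S : Finset (Fin N)} {x : Y} (hx : IsWeightVector E S x)
    (hup : ∀ a b, a < b → E a b x = 0) :
    ∃ L : Submodule K Y, IsStable E L ∧ x ∈ L ∧
      ∀ y ∈ L, IsWeightVector E S y → ∃ c : K, y = c • x := by
  let L : Submodule K Y :=
    sInf {W | x ∈ W ∧ ∀ c d, d < c → ∀ y ∈ W, E c d y ∈ W}
  have hxL : x ∈ L := by
    simp only [L, Submodule.mem_sInf]
    exact fun W hW => hW.1
  have hlow : ∀ c d, d < c → ∀ y ∈ L, E c d y ∈ L := by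
    intro c d hdc y hy
    simp only [L, Submodule.mem_sInf] at hy ⊢
    exact fun W hW => hW.2 c d hdc y (hy W hW)
  have hle : ∀ W : Submodule K Y, x ∈ W → (∀ c d, d < c → ∀ y ∈ W, E c d y ∈ W) → L ≤ W :=
    fun W h1 h2 => sInf_le ⟨h1, h2⟩
  refine ⟨L, ?_, hxL, ?_⟩
  · let L' : Submodule K Y :=
      { carrier := {y | y ∈ L ∧ ∀ a b, E a b y ∈ L}
        add_mem' := fun {y z} hy hz => ⟨add_mem hy.1 hz.1, fun a b => by
          rw [map_add]; exact add_mem (hy.2 a b) (hz.2 a b)⟩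
        zero_mem' := ⟨zero_mem _, fun a b => by rw [map_zero]; exact zero_mem _⟩
        smul_mem' := fun c y hy => ⟨L.smul_mem c hy.1, fun a b => by
          rw [map_smul]; exact L.smul_mem c (hy.2 a b)⟩ }
    have hL' : L ≤ L' := by
      refine hle L' ⟨hxL, fun a b => ?_⟩ ?_
      · rcases lt_trichotomy a b with h | rfl | h
        · rw [hup a b h]; exact zero_mem _
        · rw [hx a]; split_ifs
          exacts [hxL, zero_mem _]
        · exact hlow a b h x hxL
      · rintro c d hdc y ⟨hy, hy'⟩
        refine ⟨hlow c d hdc y hy, fun a b => ?_⟩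
        rw [eq_add_of_sub_eq (comm a b c d y)]
        refine add_mem (sub_mem ?_ ?_) (hlow c d hdc _ (hy' a b)) <;> split_ifs
        exacts [hy' _ _, zero_mem _, hy' _ _, zero_mem _]
    exact fun a b y hy => (hL' hy).2 a b
  -- The operator `H = ∑ i E_ii` separates the weight of `x` from the lower ones.
  · let H : Module.End K Y := ∑ i : Fin N, ((i : ℕ) : K) • E i i
    have hH : ∀ y, H y = ∑ i : Fin N, ((i : ℕ) : K) • E i i y := fun y => by simp [H]
    let μ : K := ∑ i ∈ S, ((i : ℕ) : K)
    have hμ : ∀ y, IsWeightVector E S y → H y = μ • y := by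
      intro y hy
      simp only [hH, hy _, smul_ite, smul_zero, μ, Finset.sum_smul]
      simp
    have hcomm : ∀ c d y, H (E c d y) =
        E c d (H y) + (((c : ℕ) : K) - ((d : ℕ) : K)) • E c d y := by
      intro c d y
      have h1 : ∀ i : Fin N, ((i : ℕ) : K) • E i i (E c d y) = ((i : ℕ) : K) • E c d (E i i y) +
          ((if i = c then ((i : ℕ) : K) • E i d y else 0) -
            (if d = i then ((i : ℕ) : K) • E c i y else 0)) := by
        intro i
        rw [eq_add_of_sub_eq (comm i i c d y), smul_add, smul_sub, smul_ite, smul_ite, smul_zero]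
        abel
      simp only [hH, h1, Finset.sum_add_distrib, Finset.sum_sub_distrib, map_sum, map_smul]
      simp [sub_smul]
    let Z : Submodule K Y := ⨆ m : ℕ, Module.End.eigenspace H (μ + (m + 1 : ℕ))
    have hZ : ∀ c d, d < c → ∀ y ∈ Z, E c d y ∈ Z := by
      intro c d hdc y hy
      have hZ' : Z ≤ Z.comap (E c d) := by
        refine iSup_le fun m y hy => ?_
        rw [Module.End.mem_eigenspace_iff] at hy
        have hle : (d : ℕ) ≤ c := by exact_mod_cast hdc.le
        refine Submodule.mem_iSup_of_mem (m + ((c : ℕ) - d)) ?_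
        rw [Module.End.mem_eigenspace_iff, hcomm, hy, map_smul, ← add_smul]
        congr 1
        push_cast [Nat.cast_sub hle]
        ring
      exact hZ' hy
    have hLZ : L ≤ K ∙ x ⊔ Z := by
      refine hle _ (Submodule.mem_sup_left (Submodule.mem_span_singleton_self x)) ?_
      intro c d hdc y hy
      obtain ⟨y₁, hy₁, y₂, hy₂, rfl⟩ := Submodule.mem_sup.mp hy
      obtain ⟨t, rfl⟩ := Submodule.mem_span_singleton.mp hy₁
      rw [map_add, map_smul]
      refine add_mem (Submodule.smul_mem _ _ (Submodule.mem_sup_right ?_))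
        (Submodule.mem_sup_right (hZ c d hdc _ hy₂))
      have hle : (d : ℕ) < c := by exact_mod_cast hdc
      refine Submodule.mem_iSup_of_mem ((c : ℕ) - d - 1) ?_
      rw [Module.End.mem_eigenspace_iff, hcomm, hμ x hx, map_smul, ← add_smul,
        show (c : ℕ) - d - 1 + 1 = (c : ℕ) - d by omega, Nat.cast_sub hle.le]
    intro y hy hyS
    obtain ⟨y₁, hy₁, y₂, hy₂, rfl⟩ := Submodule.mem_sup.mp (hLZ hy)
    obtain ⟨t, rfl⟩ := Submodule.mem_span_singleton.mp hy₁
    have h2 : y₂ ∈ Module.End.eigenspace H μ := by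
      rw [Module.End.mem_eigenspace_iff]
      have := hμ _ hyS
      rw [map_add, map_smul, hμ x hx, smul_add, smul_comm] at this
      exact add_left_cancel this
    have hdisj := (Module.End.eigenspaces_iSupIndep H) μ
    have hZle : Z ≤ ⨆ (ν : K) (_ : ν ≠ μ), Module.End.eigenspace H ν := by
      refine iSup_le fun m => ?_
      refine le_iSup₂_of_le (μ + (m + 1 : ℕ)) ?_ le_rfl
      rw [Ne, add_eq_left]
      exact Nat.cast_ne_zero.mpr (Nat.succ_ne_zero m)
    have : y₂ = 0 := Submodule.disjoint_def.mp hdisj y₂ h2 (hZle hy₂)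
    exact ⟨t, by rw [this, add_zero]⟩

/-- A simple fermionic module with a highest weight vector of weight `S` is isomorphic to any
fermionic module with a basis of weight vectors indexed by the subsets of cardinality `|S|`: the
submodule of their direct sum generated by the pair of highest weight vectors is the graph of an
isomorphism. -/
theorem exists_equiv_of_isWeightVector [CharZero K] {E : Fin N → Fin N → Module.End K Y}
    (hE : IsFermionic E) (hsimple : ∀ Z, IsStable E Z → Z = ⊥ ∨ Z = ⊤)
    {S : Finset (Fin N)} (hS : IsLowerSet (S : Set (Fin N))) {y₀ : Y} (hy₀ : y₀ ≠ 0)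
    (hw : IsWeightVector E S y₀)
    {Λ : Type w} [AddCommGroup Λ] [Module K Λ] {F : Fin N → Fin N → Module.End K Λ}
    (hF : IsFermionic F) (b : Module.Basis (Set.powersetCard (Fin N) S.card) K Λ)
    (hb : ∀ R : Set.powersetCard (Fin N) S.card, IsWeightVector F (R : Finset (Fin N)) (b R)) :
    ∃ e : Y ≃ₗ[K] Λ, ∀ a c y, e (E a c y) = F a c (e y) := by
  let S' : Set.powersetCard (Fin N) S.card := ⟨S, rfl⟩
  let G : Fin N → Fin N → Module.End K (Y × Λ) := fun a c => (E a c).prodMap (F a c)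
  have hG : ∀ a c y z, G a c (y, z) = (E a c y, F a c z) := fun _ _ _ _ => rfl
  have hup : ∀ a c, a < c → c ∉ S ∨ a ∈ S := by
    intro a c hac
    by_cases hc : c ∈ S
    · exact Or.inr (hS hac.le hc)
    · exact Or.inl hc
  obtain ⟨L, hL, hxL, hwt⟩ := exists_cyclic (E := G) (S := S) (x := (y₀, b S'))
    (by
      rintro a b c d ⟨y, z⟩
      have h1 := hE.comm a b c d y
      have h2 := hF.comm a b c d z
      simp only [hG, Prod.mk_sub_mk, h1, h2]
      split_ifs <;> simp)
    (by
      intro a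
      rw [hG, hw a, hb S' a]
      by_cases h : a ∈ S <;> simp [S', h])
    (by
      intro a c hac
      rw [hG, hE.apply_eq_zero hw hac.ne (hup a c hac),
        hF.apply_eq_zero (hb S') hac.ne (hup a c hac)]
      rfl)
  -- Neither component of the pair of highest weight vectors is in `L` by itself, as the weight
  -- space of `L` is a line. Hence `L` meets both factors trivially.
  have hnot₁ : (y₀, (0 : Λ)) ∉ L := by
    intro h
    obtain ⟨c, hc⟩ := hwt _ h (by
      intro a
      rw [hG, hw a, map_zero]
      split_ifs <;> rfl)
    rw [Prod.smul_mk, Prod.mk.injEq] at hc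
    have hc0 : c = 0 := (smul_eq_zero.mp hc.2.symm).resolve_right (b.ne_zero S')
    exact hy₀ (by rw [hc.1, hc0, zero_smul])
  have hnot₂ : ((0 : Y), b S') ∉ L := by
    intro h
    obtain ⟨c, hc⟩ := hwt _ h (by
      intro a
      rw [hG, hb S' a, map_zero]
      by_cases h : a ∈ S <;> simp [S', h])
    rw [Prod.smul_mk, Prod.mk.injEq] at hc
    have hc0 : c = 0 := (smul_eq_zero.mp hc.1.symm).resolve_right hy₀
    exact b.ne_zero S' (by rw [hc.2, hc0, zero_smul])
  have hstab : ∀ p ∈ L, ∀ a c, (E a c p.1, F a c p.2) ∈ L := fun p hp a c => hL a c p hp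
  let f₁ : L →ₗ[K] Y := (LinearMap.fst K Y Λ).comp L.subtype
  let f₂ : L →ₗ[K] Λ := (LinearMap.snd K Y Λ).comp L.subtype
  have hf₁ : Function.Bijective f₁ := by
    constructor
    · rw [← LinearMap.ker_eq_bot, LinearMap.ker_eq_bot']
      let Z : Submodule K Λ := L.comap (LinearMap.inr K Y Λ)
      have hZ : Z = ⊥ := by
        by_contra hne
        obtain ⟨T, hT, z, hz, hz0, hzT⟩ := hF.exists_isWeightVector_isLowerSet (Z := Z)
          (fun a c z hz => by simpa [Z] using hstab _ hz a c) hne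
        obtain ⟨hcard, heq⟩ := eq_smul_of_isWeightVector b hb hzT hz0
        have hTS : (⟨T, hcard⟩ : Set.powersetCard (Fin N) S.card) = S' :=
          Subtype.ext (eq_of_isLowerSet hT hS hcard)
        rw [hTS] at heq
        have hc0 : b.repr z S' ≠ 0 := fun h => hz0 (by rw [heq, h, zero_smul])
        have : b S' ∈ Z := by
          rw [heq] at hz
          exact (Submodule.smul_mem_iff _ hc0).mp hz
        exact hnot₂ this
      rintro ⟨⟨y, z⟩, hyz⟩ h
      obtain rfl : y = 0 := h
      have : z ∈ Z := hyz
      rw [hZ, Submodule.mem_bot] at this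
      subst this
      rfl
    · rw [← LinearMap.range_eq_top]
      refine (hsimple _ ?_).resolve_left ?_
      · rintro a c _ ⟨⟨p, hp⟩, rfl⟩
        exact ⟨⟨_, hstab p hp a c⟩, rfl⟩
      · exact fun h => hy₀ ((Submodule.mem_bot K).mp (h ▸ ⟨⟨_, hxL⟩, rfl⟩))
  have hf₂ : Function.Bijective f₂ := by
    constructor
    · rw [← LinearMap.ker_eq_bot, LinearMap.ker_eq_bot']
      let Z : Submodule K Y := L.comap (LinearMap.inl K Y Λ)
      have hZ : Z = ⊥ := by
        refine (hsimple Z fun a c y hy => ?_).resolve_right fun h => hnot₁ ?_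
        · simpa [Z] using hstab _ hy a c
        · have : y₀ ∈ Z := h ▸ Submodule.mem_top
          exact this
      rintro ⟨⟨y, z⟩, hyz⟩ h
      obtain rfl : z = 0 := h
      have : y ∈ Z := hyz
      rw [hZ, Submodule.mem_bot] at this
      subst this
      rfl
    · rw [← LinearMap.range_eq_top]
      refine eq_top_of_mem_isLowerSet b hb hF (S := S') hS ?_ ⟨⟨_, hxL⟩, rfl⟩
      rintro a c _ ⟨⟨p, hp⟩, rfl⟩
      exact ⟨⟨_, hstab p hp a c⟩, rfl⟩
  let e₁ := LinearEquiv.ofBijective f₁ hf₁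
  let e₂ := LinearEquiv.ofBijective f₂ hf₂
  refine ⟨e₁.symm.trans e₂, fun a c y => ?_⟩
  obtain ⟨p, rfl⟩ := e₁.surjective y
  have h1 : E a c (e₁ p) = e₁ ⟨_, hstab p.1 p.2 a c⟩ := rfl
  rw [h1]
  simp only [LinearEquiv.trans_apply, LinearEquiv.symm_apply_apply]
  rfl

end Cyclic

end Fermionic

/-! ### Matrix units acting on `gl_N`-modules -/

section MatrixUnits

variable {K : Type u} [Field K] {N : ℕ} (U : Type v) [AddCommGroup U] [Module K U]
  [LieRingModule (Matrix (Fin N) (Fin N) K) U] [LieModule K (Matrix (Fin N) (Fin N) K) U]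

variable (K) in
/-- The action of the matrix unit `E_{ab}` on a `gl_N`-module. -/
noncomputable def unitAction (a b : Fin N) : Module.End K U :=
  LieModule.toEnd K (Matrix (Fin N) (Fin N) K) U (Matrix.single a b 1)

theorem unitAction_apply (a b : Fin N) (y : U) :
    unitAction K U a b y = ⁅(Matrix.single a b 1 : Matrix (Fin N) (Fin N) K), y⁆ := rfl

theorem unitAction_comm (a b c d : Fin N) (y : U) :
    unitAction K U a b (unitAction K U c d y) - unitAction K U c d (unitAction K U a b y) =
      (if b = c then unitAction K U a d y else 0) -
        (if d = a then unitAction K U c b y else 0) := by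
  simp only [unitAction_apply]
  rw [← lie_lie, Ring.lie_def, sub_lie]
  congr 1
  · split_ifs with h
    · subst h; simp
    · simp [h]
  · split_ifs with h
    · subst h; simp
    · simp [h]

theorem lie_eq_sum_unitAction (x : Matrix (Fin N) (Fin N) K) (y : U) :
    ⁅x, y⁆ = ∑ a, ∑ b, x a b • unitAction K U a b y := by
  conv_lhs => rw [Matrix.matrix_eq_sum_single x]
  simp only [unitAction_apply, ← smul_lie, Matrix.smul_single,
    smul_eq_mul, mul_one]
  rw [sum_lie]
  simp_rw [sum_lie]

variable {U}

/-- A subspace stable under the matrix units is a submodule. -/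
noncomputable def stableLieSubmodule (Z : Submodule K U)
    (hZ : IsStable (unitAction K (N := N) U) Z) :
    LieSubmodule K (Matrix (Fin N) (Fin N) K) U where
  toSubmodule := Z
  lie_mem := by
    intro x y hy
    rw [lie_eq_sum_unitAction]
    exact sum_mem fun a _ => sum_mem fun b _ => Z.smul_mem _ (hZ a b y hy)

theorem eq_bot_or_eq_top_of_isStable [LieModule.IsIrreducible K (Matrix (Fin N) (Fin N) K) U]
    (Z : Submodule K U) (hZ : IsStable (unitAction K (N := N) U) Z) : Z = ⊥ ∨ Z = ⊤ := by
  rcases eq_bot_or_eq_top (stableLieSubmodule Z hZ) with h | h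
  · exact Or.inl (congrArg LieSubmodule.toSubmodule h)
  · exact Or.inr (congrArg LieSubmodule.toSubmodule h)

/-- Burnside's theorem for the matrix units: on a simple module they generate all
endomorphisms. -/
theorem adjoin_unitAction_eq_top [IsAlgClosed K] [FiniteDimensional K U]
    [LieModule.IsIrreducible K (Matrix (Fin N) (Fin N) K) U] :
    Algebra.adjoin K {f | ∃ a b, f = unitAction K (N := N) U a b} = ⊤ := by
  set R := Algebra.adjoin K {f | ∃ a b, f = unitAction K (N := N) U a b} with hR
  have hmem : ∀ a b, unitAction K (N := N) U a b ∈ R :=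
    fun a b => Algebra.subset_adjoin ⟨a, b, rfl⟩
  have hnt : Nontrivial U := LieModule.nontrivial_of_isIrreducible K (Matrix (Fin N) (Fin N) K) U
  have hsimple : IsSimpleModule R U := by
    rw [isSimpleModule_iff]
    refine { exists_pair_ne := ⟨⊥, ⊤, bot_ne_top⟩, eq_bot_or_eq_top := fun Z => ?_ }
    rcases eq_bot_or_eq_top_of_isStable (K := K) (N := N) (Z.restrictScalars K)
      (fun a b y hy => Z.smul_mem (⟨_, hmem a b⟩ : R) hy) with h | h
    · exact Or.inl ((Submodule.restrictScalars_eq_bot_iff K _ _).mp h)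
    · exact Or.inr ((Submodule.restrictScalars_eq_top_iff K _ _).mp h)
  -- By Schur's lemma the `R`-endomorphisms are scalars, so the density theorem applies to all `f`.
  have hschur := IsSimpleModule.algebraMap_end_bijective_of_isAlgClosed (A := R) (V := U) K
  rw [eq_top_iff]
  intro f _
  let f' : Module.End (Module.End R U) U :=
    { toFun := f
      map_add' := map_add f
      map_smul' := fun c y => by
        obtain ⟨t, rfl⟩ := hschur.2 c
        exact map_smul f t y }
  obtain ⟨s, hs⟩ := (inferInstance : Module.Finite K U).fg_top
  obtain ⟨r, hr⟩ := jacobson_density (R := R) f' s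
  have hfr : f = (r : Module.End K U) := by
    apply LinearMap.ext_on (by rw [hs] : Submodule.span K (s : Set U) = ⊤)
    exact fun y hy => hr y hy
  rw [hfr]
  exact r.2

/-- The vectors killed by the quadratic relations of the fermionic modules form a submodule, so if
a simple module has a non-zero such vector, then the relations hold on all of it. -/
theorem isFermionic_of_ne_zero [LieModule.IsIrreducible K (Matrix (Fin N) (Fin N) K) U]
    {y : U} (hy : y ≠ 0)
    (h : ∀ s i r j : Fin N, unitAction K U s i (unitAction K U r j y) +
      unitAction K U r i (unitAction K U s j y) =
      (if i = s then unitAction K U r j y else 0) +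
        (if i = r then unitAction K U s j y else 0)) :
    IsFermionic (unitAction K (N := N) U) := by
  let E := unitAction K (N := N) U
  let T : Fin N → Fin N → Fin N → Fin N → Module.End K U := fun s i r j =>
    E s i * E r j + E r i * E s j - (if i = s then E r j else 0) - (if i = r then E s j else 0)
  have hT : ∀ s i r j z, T s i r j z = E s i (E r j z) + E r i (E s j z) -
      (if i = s then E r j z else 0) - (if i = r then E s j z else 0) := by
    intro s i r j z
    simp only [T]
    split_ifs <;> simp
  have hc : ∀ a b c d : Fin N, E a b * E c d = E c d * E a b +
      ((if b = c then E a d else 0) - (if d = a then E c b else 0)) := by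
    intro a b c d
    ext z
    have h1 := eq_add_of_sub_eq (unitAction_comm (K := K) (N := N) U a b c d z)
    simp only [LinearMap.add_apply, Module.End.mul_apply, LinearMap.sub_apply]
    rw [add_comm]
    refine h1.trans ?_
    split_ifs <;> simp [E]
  have hite : ∀ (p : Prop) [Decidable p] (X : Module.End K U),
      (if p then X else 0) = (if p then (1 : K) else 0) • X := by
    intro p _ X
    split_ifs <;> simp
  have hcomm : ∀ a b s i r j, E a b * T s i r j = T s i r j * E a b +
      ((if b = s then T a i r j else 0) - (if i = a then T s b r j else 0) +
        (if b = r then T s i a j else 0) - (if j = a then T s i r b else 0)) := by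
    intro a b s i r j
    have h1 : ∀ c d c' d' : Fin N, E a b * (E c d * E c' d') = E c d * (E c' d' * E a b) +
        (E c d * ((if b = c' then E a d' else 0) - (if d' = a then E c' b else 0)) +
        ((if b = c then E a d else 0) - (if d = a then E c b else 0)) * E c' d') := by
      intro c d c' d'
      rw [← mul_assoc, hc a b c d, add_mul, mul_assoc, hc a b c' d', mul_add, add_assoc]
    simp only [T, hite, mul_add, mul_sub, h1, mul_smul_comm, hc a b, smul_mul_assoc, add_mul,
      sub_mul, mul_assoc]
    module
  let Z : Submodule K U := ⨅ s, ⨅ i, ⨅ r, ⨅ j, LinearMap.ker (T s i r j)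
  have hmemZ : ∀ z, z ∈ Z ↔ ∀ s i r j, T s i r j z = 0 := by
    intro z
    simp [Z]
  have hZ : IsStable E Z := by
    intro a b z hz
    rw [hmemZ] at hz ⊢
    intro s i r j
    have h1 := LinearMap.congr_fun (hcomm a b s i r j) z
    simp only [LinearMap.add_apply, Module.End.mul_apply, LinearMap.sub_apply, hz, map_zero] at h1
    simpa only [hite, LinearMap.smul_apply, hz, smul_zero, sub_zero, add_zero, eq_comm] using h1
  have hyZ : y ∈ Z := by
    rw [hmemZ]
    intro s i r j
    rw [hT, sub_sub, sub_eq_zero]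
    exact h s i r j
  have hZtop : Z = ⊤ := (eq_bot_or_eq_top_of_isStable Z hZ).resolve_left
    (fun h => hy ((Submodule.mem_bot K).mp (h ▸ hyZ)))
  refine ⟨unitAction_comm U, fun s i r j z => ?_⟩
  have := (hmemZ z).mp (hZtop ▸ Submodule.mem_top) s i r j
  rwa [hT, sub_sub, sub_eq_zero] at this

end MatrixUnits

/-! ### The exterior powers are fermionic -/

section ExteriorUnits

variable {K : Type u} [Field K] {N : ℕ}

theorem toLin'_single_apply (a b : Fin N) (v : Fin N → K) :
    Matrix.toLin' (Matrix.single a b (1 : K)) v = v b • Pi.single a 1 := by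
  ext i
  simp [Pi.single_apply, Matrix.single_mulVec, Function.update_apply, eq_comm]

/-- On the exterior algebra, `E_{ab}` is the contraction with `e_b^*` followed by `e_a ∧`. -/
theorem extDer_single (a b : Fin N) (x : ExteriorAlgebra K (Fin N → K)) :
    extDer (Matrix.toLin' (Matrix.single a b (1 : K))) x =
      ExteriorAlgebra.ι K (Pi.single a 1) *
        CliffordAlgebra.contractLeft (LinearMap.proj b) x := by
  induction x using CliffordAlgebra.left_induction with
  | algebraMap r =>
    rw [extDer_algebraMap, CliffordAlgebra.contractLeft_algebraMap, mul_zero]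
  | add x y hx hy => rw [map_add, map_add, mul_add, hx, hy]
  | ι_mul x v hx =>
    have h1 : extDer (Matrix.toLin' (Matrix.single a b (1 : K))) (ExteriorAlgebra.ι K v * x) =
        ExteriorAlgebra.ι K v *
            (ExteriorAlgebra.ι K (Pi.single a 1) *
              CliffordAlgebra.contractLeft (LinearMap.proj b) x) +
          v b • ExteriorAlgebra.ι K (Pi.single a 1) * x := by
      rw [extDer_mul, extDer_ι, hx, toLin'_single_apply, map_smul]
    refine h1.trans ?_
    have h2 : ExteriorAlgebra.ι K v * ExteriorAlgebra.ι K (Pi.single a 1) =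
        -(ExteriorAlgebra.ι K (Pi.single a 1) * ExteriorAlgebra.ι K v) :=
      eq_neg_of_add_eq_zero_left (ExteriorAlgebra.ι_add_mul_swap v _)
    rw [CliffordAlgebra.contractLeft_ι_mul, ← mul_assoc, h2, mul_sub, mul_smul_comm,
      smul_mul_assoc, neg_mul, mul_assoc, LinearMap.proj_apply]
    abel

/-- The action of `gl_N` on the exterior powers satisfies the fermionic relations. -/
theorem isFermionic_exteriorPower (k : ℕ) :
    IsFermionic (unitAction K (N := N) (⋀[K]^k (Fin N → K))) := by
  refine ⟨unitAction_comm _, fun s i r j y => ?_⟩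
  have hcoe : ∀ (a b : Fin N) (z : ⋀[K]^k (Fin N → K)),
      ((unitAction K (⋀[K]^k (Fin N → K)) a b z : ⋀[K]^k (Fin N → K)) :
        ExteriorAlgebra K (Fin N → K)) = ExteriorAlgebra.ι K (Pi.single a 1) *
        CliffordAlgebra.contractLeft (LinearMap.proj b) (z : ExteriorAlgebra K (Fin N → K)) :=
    fun a b z => extDer_single (K := K) a b z.1
  have hanti : ∀ z : ExteriorAlgebra K (Fin N → K),
      ExteriorAlgebra.ι K (Pi.single s 1) * (ExteriorAlgebra.ι K (Pi.single r 1) * z) =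
        -(ExteriorAlgebra.ι K (Pi.single r 1) * (ExteriorAlgebra.ι K (Pi.single s 1) * z)) := by
    intro z
    rw [← mul_assoc, ← mul_assoc, ← neg_mul]
    congr 1
    exact eq_neg_of_add_eq_zero_left (ExteriorAlgebra.ι_add_mul_swap _ _)
  have hprod : ∀ (a b c d : Fin N) (z : ExteriorAlgebra K (Fin N → K)),
      ExteriorAlgebra.ι K (Pi.single a 1) * CliffordAlgebra.contractLeft (LinearMap.proj b)
        (ExteriorAlgebra.ι K (Pi.single c 1) *
          CliffordAlgebra.contractLeft (LinearMap.proj d) z) =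
      (if b = c then ExteriorAlgebra.ι K (Pi.single a 1) *
          CliffordAlgebra.contractLeft (LinearMap.proj d) z else 0) -
        ExteriorAlgebra.ι K (Pi.single a 1) * (ExteriorAlgebra.ι K (Pi.single c 1) *
          CliffordAlgebra.contractLeft (LinearMap.proj b)
            (CliffordAlgebra.contractLeft (LinearMap.proj d) z)) := by
    intro a b c d z
    rw [CliffordAlgebra.contractLeft_ι_mul, mul_sub, LinearMap.proj_apply, Pi.single_apply]
    congr 1
    split_ifs <;> simp
  have hite : ∀ (p : Prop) [Decidable p] (z : ⋀[K]^k (Fin N → K)),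
      (((if p then z else 0 : ⋀[K]^k (Fin N → K))) : ExteriorAlgebra K (Fin N → K)) =
        if p then (z : ExteriorAlgebra K (Fin N → K)) else 0 := by
    intro p _ z
    split_ifs <;> rfl
  ext
  rw [Submodule.coe_add, Submodule.coe_add, hite, hite]
  simp only [hcoe]
  rw [hprod, hprod, hanti]
  abel

theorem extDer_diag_prod (a : Fin N) (l : List (Fin N)) :
    extDer (Matrix.toLin' (Matrix.single a a (1 : K)))
        (l.map fun i => ExteriorAlgebra.ι K (Pi.single i (1 : K))).prod =
      l.count a • (l.map fun i => ExteriorAlgebra.ι K (Pi.single i (1 : K))).prod := by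
  induction l with
  | nil =>
    simpa using extDer_algebraMap (Matrix.toLin' (Matrix.single a a (1 : K))) 1
  | cons b l ih =>
    rw [List.map_cons, List.prod_cons, extDer_mul, ih, extDer_ι, toLin'_single_apply,
      List.count_cons, add_smul, mul_smul_comm]
    congr 1
    rcases eq_or_ne a b with rfl | h
    · simp
    · simp [h, h.symm]

/-- The standard basis of the exterior power consists of weight vectors. -/
theorem isWeightVector_basis (k : ℕ) (R : Set.powersetCard (Fin N) k) :
    IsWeightVector (unitAction K (N := N) (⋀[K]^k (Fin N → K))) (R : Finset (Fin N))
      ((Pi.basisFun K (Fin N)).exteriorPower k R) := by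
  intro a
  set l : List (Fin N) := List.ofFn fun i => Set.powersetCard.ofFinEmbEquiv.symm R i with hl
  have hnodup : l.Nodup :=
    List.nodup_ofFn.mpr (Set.powersetCard.ofFinEmbEquiv.symm R).injective
  have hmem : a ∈ l ↔ a ∈ (R : Finset (Fin N)) := by
    rw [hl, List.mem_ofFn]
    exact Set.powersetCard.mem_range_ofFinEmbEquiv_symm_iff_mem R a
  have hbasis : (((Pi.basisFun K (Fin N)).exteriorPower k R : ⋀[K]^k (Fin N → K)) :
      ExteriorAlgebra K (Fin N → K)) =
      (l.map fun i => ExteriorAlgebra.ι K (Pi.single i (1 : K))).prod := by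
    rw [exteriorPower.basis_apply, exteriorPower.ιMulti_family_apply_coe,
      ExteriorAlgebra.ιMulti_family, ExteriorAlgebra.ιMulti_apply, hl, List.map_ofFn]
    congr 2
    ext i
    simp
  ext
  refine Eq.trans (b := extDer (Matrix.toLin' (Matrix.single a a (1 : K)))
    ((Pi.basisFun K (Fin N)).exteriorPower k R : ⋀[K]^k (Fin N → K)).1) rfl ?_
  rw [hbasis, extDer_diag_prod, hnodup.count, ← hbasis]
  simp only [hmem]
  split_ifs <;> simp

end ExteriorUnits

/-- A simple `gl_N`-module on which the fermionic relations hold is an exterior power. -/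
theorem exists_equiv_exteriorPower {K : Type u} [Field K] [CharZero K] {N : ℕ} {U : Type v}
    [AddCommGroup U] [Module K U] [LieRingModule (Matrix (Fin N) (Fin N) K) U]
    [LieModule K (Matrix (Fin N) (Fin N) K) U]
    [LieModule.IsIrreducible K (Matrix (Fin N) (Fin N) K) U]
    (hU : IsFermionic (unitAction K (N := N) U)) :
    ∃ k ≤ N, Nonempty (U ≃ₗ⁅K, Matrix (Fin N) (Fin N) K⁆ ⋀[K]^k (Fin N → K)) := by
  have hnt : Nontrivial U := LieModule.nontrivial_of_isIrreducible K (Matrix (Fin N) (Fin N) K) U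
  obtain ⟨S, hS, y, -, hy0, hy⟩ := hU.exists_isWeightVector_isLowerSet (Z := ⊤)
    (fun _ _ _ _ => Submodule.mem_top) top_ne_bot
  obtain ⟨e, he⟩ := exists_equiv_of_isWeightVector hU eq_bot_or_eq_top_of_isStable hS hy0 hy
    (isFermionic_exteriorPower S.card) _ (isWeightVector_basis S.card)
  refine ⟨S.card, by simpa using S.card_le_univ, ⟨{ e with map_lie' := ?_ }⟩⟩
  intro x z
  change e ⁅x, z⁆ = ⁅x, e z⁆
  rw [lie_eq_sum_unitAction, lie_eq_sum_unitAction]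
  simp only [map_sum, map_smul, he]

/-! ### Differential ideals -/

section DifferentialIdeals

theorem exists_totalDegree_pderiv_lt {K : Type u} [Field K] [CharZero K]
    {σ : Type v} {P : MvPolynomial σ K} (hP : P.totalDegree ≠ 0) :
    ∃ i, MvPolynomial.pderiv i P ≠ 0 ∧ (MvPolynomial.pderiv i P).totalDegree < P.totalDegree := by
  classical
  have h1 : ∃ m ∈ P.support, m ≠ 0 := by
    by_contra! h
    exact hP ((MvPolynomial.totalDegree_eq_zero_iff _ _).mpr fun m hm i => by simp [h m hm])
  obtain ⟨m, hm, hm0⟩ := h1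
  obtain ⟨i, hi⟩ := Finsupp.ne_iff.mp hm0
  have hi' : Finsupp.single i 1 ≤ m := by
    simpa [Nat.one_le_iff_ne_zero] using hi
  refine ⟨i, fun h => ?_, ?_⟩
  · have h2 := MvPolynomial.coeff_pderiv (i := i) P (m - Finsupp.single i 1)
    rw [h, MvPolynomial.coeff_zero, tsub_add_cancel_of_le hi'] at h2
    refine mul_ne_zero (MvPolynomial.mem_support_iff.mp hm) ?_ h2.symm
    exact Nat.cast_add_one_ne_zero _
  · rw [MvPolynomial.totalDegree, Finset.sup_lt_iff (by simpa using Nat.pos_of_ne_zero hP)]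
    intro m' hm'
    have h2 : m' + Finsupp.single i 1 ∈ P.support := by
      rw [MvPolynomial.mem_support_iff] at hm' ⊢
      intro h
      exact hm' (by rw [MvPolynomial.coeff_pderiv, h, zero_mul])
    have h3 := MvPolynomial.le_totalDegree h2
    rw [Finsupp.sum_add_index' (by simp) (by simp)] at h3
    simp at h3
    omega

variable {K : Type u} [Field K] {A : Type v} [CommRing A] [Algebra K A] {h : A}
  {N : ℕ} (c : ChartParameters K h N)

theorem ChartParameters.der_aeval (i : Fin N) (P : MvPolynomial (Fin N) K) :
    c.der i (algebraMap A (Localization.Away h) (MvPolynomial.aeval c.t P)) =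
      algebraMap A (Localization.Away h) (MvPolynomial.aeval c.t (MvPolynomial.pderiv i P)) := by
  induction P using MvPolynomial.induction_on with
  | C a =>
    rw [MvPolynomial.aeval_C, ← IsScalarTower.algebraMap_apply, Derivation.map_algebraMap,
      MvPolynomial.pderiv_C, map_zero, map_zero]
  | add P Q hP hQ => simp only [map_add, hP, hQ]
  | mul_X P j hP =>
    simp only [map_mul, Derivation.leibniz, hP, MvPolynomial.aeval_X, c.der_t, map_add,
      MvPolynomial.pderiv_X, smul_eq_mul]
    rcases eq_or_ne i j with rfl | hij
    · simp
    · simp [hij, hij.symm]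

theorem injective_algebraMap_away [IsDomain A] (hh : h ≠ 0) :
    Function.Injective (algebraMap A (Localization.Away h)) :=
  IsLocalization.injective _ (powers_le_nonZeroDivisors_of_noZeroDivisors hh)

/-- The localized coordinate ring is differentially simple with respect to the `∂/∂t_i`: a
non-zero differential ideal contains a non-zero polynomial in the chart parameters, since the ring
is algebraic over these polynomials, and differentiating reduces it to a non-zero constant. -/
theorem ChartParameters.eq_top_of_der_mem [CharZero K] [IsDomain A] (hh : h ≠ 0)
    {J : Ideal (Localization.Away h)} (hJ : ∀ i, ∀ f ∈ J, c.der i f ∈ J) (hne : J ≠ ⊥) :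
    J = ⊤ := by
  have hinj := injective_algebraMap_away hh
  obtain ⟨f, hf, hf0⟩ := J.ne_bot_iff.mp hne
  obtain ⟨⟨a, b⟩, hab⟩ := IsLocalization.surj (Submonoid.powers h) f
  have hb : IsUnit (algebraMap A (Localization.Away h) b) := IsLocalization.map_units _ b
  have ha : algebraMap A (Localization.Away h) a ∈ J := by
    rw [← hab]; exact J.mul_mem_right _ hf
  have ha0 : a ≠ 0 := by
    rintro rfl
    rw [map_zero] at hab
    exact hf0 ((hb.mul_left_eq_zero).mp hab)
  obtain ⟨r, hr0, hr⟩ := (c.isAlgebraic.isAlgebraic a).exists_nonzero_dvd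
    (mem_nonZeroDivisors_of_ne_zero ha0)
  have hr' : (r : A) ∈ (MvPolynomial.aeval (R := K) c.t).range := by
    rw [← Algebra.adjoin_range_eq_range_aeval]; exact r.2
  obtain ⟨P, hP⟩ := hr'
  have hP0 : P ≠ 0 := by
    rintro rfl
    rw [map_zero] at hP
    exact hr0 (Subtype.ext hP.symm)
  have hPJ : algebraMap A (Localization.Away h) (MvPolynomial.aeval c.t P) ∈ J := by
    obtain ⟨q, hq⟩ := hr
    have : (MvPolynomial.aeval c.t P : A) = a * q := hP.trans hq
    rw [this, map_mul]
    exact J.mul_mem_right _ ha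
  have key : ∀ n : ℕ, ∀ P : MvPolynomial (Fin N) K, P.totalDegree = n → P ≠ 0 →
      algebraMap A (Localization.Away h) (MvPolynomial.aeval c.t P) ∈ J → J = ⊤ := by
    intro n
    induction n using Nat.strong_induction_on with
    | _ n ih =>
      rintro P rfl hP0 hPJ
      by_cases hdeg : P.totalDegree = 0
      · obtain ⟨x, rfl⟩ : ∃ x, P = MvPolynomial.C x :=
          ⟨_, MvPolynomial.totalDegree_eq_zero_iff_eq_C.mp hdeg⟩
        have hx : x ≠ 0 := by rintro rfl; simp at hP0
        rw [MvPolynomial.aeval_C] at hPJ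
        exact J.eq_top_of_isUnit_mem hPJ (((IsUnit.mk0 x hx).map _).map _)
      · obtain ⟨i, hi0, hi⟩ := exists_totalDegree_pderiv_lt hdeg
        refine ih _ hi _ rfl hi0 ?_
        rw [← c.der_aeval]
        exact hJ i _ hPJ
  exact key _ P rfl hP0 hPJ

/-- After multiplication by a power of `h`, the derivations `∂/∂t_i` of the localized ring come
from derivations of `A`. -/
theorem ChartParameters.exists_lift [IsDomain A] [Algebra.FiniteType K A] (hh : h ≠ 0) :
    ∃ s : ℕ, ∀ (i : Fin N) (a : A), ∃ η : Derivation K A A, ∀ f,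
      algebraMap A (Localization.Away h) (η f) =
        algebraMap A (Localization.Away h) (a * h ^ s) *
          c.der i (algebraMap A (Localization.Away h) f) := by
  classical
  have hinj := injective_algebraMap_away hh
  set ψ := algebraMap A (Localization.Away h) with hψ
  obtain ⟨S, hS⟩ := (inferInstance : Algebra.FiniteType K A).out
  obtain ⟨⟨_, s, rfl⟩, hs⟩ := IsLocalization.exist_integer_multiples_of_finset
    (Submonoid.powers h)
    ((Finset.univ ×ˢ S).image fun p : Fin N × A => c.der p.1 (ψ p.2))
  refine ⟨s, fun i a => ?_⟩
  have hrange : ∀ f : A, ∃ x, ψ x = ψ (a * h ^ s) * c.der i (ψ f) := by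
    intro f
    have hf : f ∈ Algebra.adjoin K (S : Set A) := hS ▸ Algebra.mem_top
    induction hf using Algebra.adjoin_induction with
    | mem f hf =>
      obtain ⟨x, hx⟩ := hs (c.der i (ψ f)) (Finset.mem_image.mpr
        ⟨(i, f), Finset.mem_product.mpr ⟨Finset.mem_univ _, hf⟩, rfl⟩)
      refine ⟨a * x, ?_⟩
      rw [Algebra.smul_def] at hx
      rw [map_mul, map_mul, mul_assoc]
      exact congrArg _ hx
    | algebraMap r =>
      refine ⟨0, ?_⟩
      rw [hψ, ← IsScalarTower.algebraMap_apply, Derivation.map_algebraMap, mul_zero, map_zero]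
    | add f g _ _ hf hg =>
      obtain ⟨x, hx⟩ := hf
      obtain ⟨y, hy⟩ := hg
      exact ⟨x + y, by rw [map_add, hx, hy, map_add, map_add, mul_add]⟩
    | mul f g _ _ hf hg =>
      obtain ⟨x, hx⟩ := hf
      obtain ⟨y, hy⟩ := hg
      refine ⟨f * y + g * x, ?_⟩
      rw [map_add, map_mul, map_mul ψ g x, hx, hy, map_mul ψ f g, Derivation.leibniz, smul_eq_mul,
        smul_eq_mul]
      ring
  choose η hη using hrange
  let η' : A →ₗ[K] A :=
    { toFun := η
      map_add' := fun f g => hinj (by rw [map_add, hη, hη, hη, map_add, map_add, mul_add])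
      map_smul' := fun r f => hinj (by
        have h1 : ∀ x : A, ψ (r • x) = r • ψ x := fun x => by
          rw [hψ, Algebra.algebraMap_eq_smul_one, Algebra.algebraMap_eq_smul_one, smul_assoc]
        rw [RingHom.id_apply, h1, hη, hη, h1, Derivation.map_smul, mul_smul_comm]) }
  refine ⟨Derivation.mk' η' fun f g => hinj ?_, hη⟩
  change ψ (η (f * g)) = ψ (f • η g + g • η f)
  rw [smul_eq_mul, smul_eq_mul, map_add, map_mul, map_mul, hη, hη, hη, map_mul ψ f g,
    Derivation.leibniz, smul_eq_mul, smul_eq_mul]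
  ring

/-- A non-zero ideal of `A` stable under all derivations becomes the unit ideal in every chart. -/
theorem ChartParameters.exists_pow_mem (c : ChartParameters K h N) [CharZero K] [IsDomain A]
    [Algebra.FiniteType K A] (hh : h ≠ 0)
    {I : Ideal A} (hI : ∀ η : Derivation K A A, ∀ f ∈ I, η f ∈ I) (hne : I ≠ ⊥) :
    ∃ k : ℕ, h ^ k ∈ I := by
  have hinj := injective_algebraMap_away hh
  obtain ⟨s, hs⟩ := c.exists_lift hh
  have hunit : IsUnit (algebraMap A (Localization.Away h) (h ^ s)) :=
    IsLocalization.map_units _ (⟨h ^ s, s, rfl⟩ : Submonoid.powers h)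
  have htop : I.map (algebraMap A (Localization.Away h)) = ⊤ := by
    refine c.eq_top_of_der_mem hh (fun i f hf => ?_) ?_
    · induction hf using Submodule.span_induction with
      | mem f hf =>
        obtain ⟨x, hx, rfl⟩ := hf
        obtain ⟨η, hη⟩ := hs i 1
        have h1 := Ideal.mem_map_of_mem (algebraMap A (Localization.Away h)) (hI η x hx)
        rw [hη, one_mul] at h1
        exact (Ideal.unit_mul_mem_iff_mem _ hunit).mp h1
      | zero => rw [map_zero]; exact zero_mem _
      | add f g _ _ hf hg => rw [map_add]; exact add_mem hf hg
      | smul a f hf' hf =>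
        rw [smul_eq_mul, Derivation.leibniz, smul_eq_mul, smul_eq_mul]
        exact add_mem (Ideal.mul_mem_left _ _ hf) (Ideal.mul_mem_right _ _ hf')
    · rwa [Ne, Ideal.map_eq_bot_iff_of_injective hinj]
  have h1 : (1 : Localization.Away h) ∈ I.map (algebraMap A (Localization.Away h)) := by
    rw [htop]; trivial
  obtain ⟨⟨x, ⟨_, k, rfl⟩⟩, hx⟩ :=
    (IsLocalization.mem_map_algebraMap_iff (Submonoid.powers h) _).mp h1
  refine ⟨k, ?_⟩
  rw [one_mul] at hx
  have hx' : h ^ k = x := hinj hx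
  rw [hx']
  exact x.2

end DifferentialIdeals

section Smooth

/-- A matrix of rank `r` has a non-zero minor of size `r`. -/
theorem exists_det_ne_zero_of_rank_eq {K : Type u} [Field K] {m n r : ℕ}
    (M : Matrix (Fin m) (Fin n) K) (hM : M.rank = r) :
    ∃ (rows : Fin r → Fin m) (cols : Fin r → Fin n),
      (Matrix.of fun a b => M (rows a) (cols b)).det ≠ 0 := by
  have key : ∀ {m n r : ℕ} (M : Matrix (Fin m) (Fin n) K), M.rank = r →
      ∃ rows : Fin r → Fin m, LinearIndependent K (fun a => M (rows a)) := by
    intro m n r M hM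
    obtain ⟨κ, a, ha, hsp, hli⟩ := exists_linearIndependent' K (fun i => M i)
    have : Finite κ := Finite.of_injective a ha
    have := Fintype.ofFinite κ
    have hcard : Fintype.card κ = r := by
      rw [← hM, Matrix.rank_eq_finrank_span_row]
      have := finrank_span_eq_card hli
      rw [hsp] at this
      exact this.symm
    let e := (Fintype.equivFinOfCardEq hcard).symm
    exact ⟨a ∘ e, hli.comp e e.injective⟩
  obtain ⟨rows, hrows⟩ := key M hM
  let M' : Matrix (Fin r) (Fin n) K := Matrix.of fun a b => M (rows a) b
  have hM' : (Matrix.transpose M').rank = r := by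
    rw [Matrix.rank_transpose]
    have := LinearIndependent.rank_matrix (M := M') hrows
    simpa using this
  obtain ⟨cols, hcols⟩ := key (Matrix.transpose M') hM'
  refine ⟨rows, cols, ?_⟩
  have h1 := (Matrix.linearIndependent_rows_iff_isUnit
    (A := Matrix.of fun b a => M (rows a) (cols b))).mp hcols
  rw [← Matrix.det_transpose]
  exact ((Matrix.isUnit_iff_isUnit_det _).mp h1).ne_zero

/-- On a smooth variety the maximal minors of the Jacobian matrix have no common zero. -/
theorem IsSmoothIrreducible.eq_top {K : Type u} [Field K] [IsAlgClosed K] {n m N : ℕ}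
    {g : Fin m → MvPolynomial (Fin n) K} (hg : IsSmoothIrreducible g N) {I : Ideal (CoordRing g)}
    (hI : ∀ (r : ℕ) (rows : Fin r → Fin m) (cols : Fin r → Fin n), r + N = n →
      jacobianMinor g rows cols ≠ 0 → ∃ k : ℕ, jacobianMinor g rows cols ^ k ∈ I) : I = ⊤ := by
  by_contra hne
  obtain ⟨𝔪, h𝔪, hI𝔪⟩ := I.exists_le_maximal hne
  set π := Ideal.Quotient.mk (Ideal.span (Set.range g)) with hπ
  have hmax : (𝔪.comap π).IsMaximal :=
    Ideal.comap_isMaximal_of_surjective π Ideal.Quotient.mk_surjective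
  -- By the Nullstellensatz a maximal ideal containing `I` is a point `p` of the variety.
  obtain ⟨p, hp⟩ := MvPolynomial.eq_vanishingIdeal_singleton_of_isMaximal K hmax
  have hmem : ∀ P, π P ∈ 𝔪 ↔ MvPolynomial.eval p P = 0 := by
    intro P
    rw [← Ideal.mem_comap, hp, MvPolynomial.mem_vanishingIdeal_singleton_iff]
    rw [← MvPolynomial.coe_aeval_eq_eval]
    rfl
  have hzero : ∀ j, MvPolynomial.eval p (g j) = 0 := by
    intro j
    have h1 : π (g j) = 0 :=
      Ideal.Quotient.eq_zero_iff_mem.mpr (Ideal.subset_span (Set.mem_range_self j))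
    rw [← hmem, h1]
    exact zero_mem _
  have hrank := hg.rank_jacobian p hzero
  obtain ⟨rows, cols, hdet⟩ := exists_det_ne_zero_of_rank_eq
    (Matrix.of fun (j : Fin m) (i : Fin n) =>
      MvPolynomial.eval p (MvPolynomial.pderiv i (g j))) rfl
  have hminor : jacobianMinor g rows cols = π (Matrix.det (Matrix.of fun a b =>
      MvPolynomial.pderiv (cols b) (g (rows a)))) := by
    rw [RingHom.map_det]
    rfl
  have hnot : jacobianMinor g rows cols ∉ 𝔪 := by
    rw [hminor, hmem, RingHom.map_det]
    exact hdet
  obtain ⟨k, hk⟩ := hI _ rows cols hrank (fun h => hnot (h ▸ zero_mem _))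
  exact hnot (h𝔪.isPrime.mem_of_pow_mem k (hI𝔪 hk))

end Smooth

/-! ### The action of vector fields on tensor modules -/

/-- A second order difference of products of two vector fields is an operator of order zero: the
element `(a ⊗ 1 - 1 ⊗ a) (b ⊗ 1 - 1 ⊗ b)` vanishes to second order on the diagonal, so all
derivatives of the vector it is applied to drop out. -/
theorem quadratic_identity {R : Type u} {Y : Type v} [CommRing R] [AddCommGroup Y] [Module R Y]
    {X : R → Y →+ Y} {X' : R → Y → Y} {G : R → Y →ₗ[R] Y} {G' : R → Y → Y} {δ : R → R}
    (hδ : ∀ a b, δ (a * b) = a * δ b + b * δ a)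
    (hX : ∀ a f y, X (a * f) y = a • X f y + f • G a y)
    (hX' : ∀ a f y, X' (a * f) y = a • X' f y + f • G' a y)
    (hs : ∀ f a y, X f (a • y) = a • X f y + (f * δ a) • y) (a b f g : R) (y : Y) :
    X (a * (b * f)) (X' g y) - X (a * f) (X' (b * g) y) - X (b * f) (X' (a * g) y) +
        X f (X' (a * (b * g)) y) =
      (f * g) • (δ a • G' b y + δ b • G' a y - G a (G' b y) - G b (G' a y)) := by
  simp only [hX, hX', hs, map_add, map_smul, hδ]
  module

section TensorModule

variable {K : Type u} [Field K] {A : Type v} [CommRing A] [Algebra K A] {h : A} {N : ℕ}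
  (c : ChartParameters K h N) {U : Type w} [AddCommGroup U] [Module K U]
  (B : Fin N → Module.End (Localization.Away h) (Localization.Away h ⊗[K] U))

/-- The covariant derivative `∂/∂t_i + B_i`. -/
noncomputable def covDer (i : Fin N) : Module.End K (Localization.Away h ⊗[K] U) :=
  c.derTensor U i + (B i).restrictScalars K

theorem derTensor_tmul (i : Fin N) (f : Localization.Away h) (u : U) :
    c.derTensor U i (f ⊗ₜ u) = c.der i f ⊗ₜ[K] u := rfl

theorem derTensor_smul (i : Fin N) (f : Localization.Away h) (y : Localization.Away h ⊗[K] U) :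
    c.derTensor U i (f • y) = c.der i f • y + f • c.derTensor U i y := by
  induction y with
  | zero => simp
  | tmul a u =>
    rw [TensorProduct.smul_tmul', derTensor_tmul, derTensor_tmul, smul_eq_mul, Derivation.leibniz,
      TensorProduct.smul_tmul', TensorProduct.smul_tmul', ← TensorProduct.add_tmul, smul_eq_mul,
      smul_eq_mul, smul_eq_mul, add_comm, mul_comm a]
  | add y z hy hz => simp only [smul_add, map_add, hy, hz]; abel

theorem covDer_smul (i : Fin N) (f : Localization.Away h) (y : Localization.Away h ⊗[K] U) :
    covDer c B i (f • y) = c.der i f • y + f • covDer c B i y := by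
  simp only [covDer, LinearMap.add_apply, LinearMap.restrictScalars_apply, derTensor_smul,
    map_smul, smul_add, add_assoc]

variable [LieRingModule (Matrix (Fin N) (Fin N) K) U] [LieModule K (Matrix (Fin N) (Fin N) K) U]

variable (h U) in
/-- The operator `1 ⊗ E_{pi}` on `A_(h) ⊗ U`. -/
noncomputable def unitTensor (p i : Fin N) :
    Module.End (Localization.Away h) (Localization.Away h ⊗[K] U) :=
  (unitAction K U p i).baseChange (Localization.Away h)

theorem unitTensor_tmul (p i : Fin N) (f : Localization.Away h) (u : U) :
    unitTensor h U p i (f ⊗ₜ[K] u) = f ⊗ₜ unitAction K U p i u := rfl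

variable (U) in
/-- The part `∑_p ∂f/∂t_p ⊗ E_{pi}` of order zero of the action of `f ∂/∂t_i`. -/
noncomputable def gradOp (i : Fin N) (f : Localization.Away h) :
    Module.End (Localization.Away h) (Localization.Away h ⊗[K] U) :=
  ∑ p, c.der p f • unitTensor h U p i

/-- The action of the vector field `f ∂/∂t_i` when `L₊` acts through `gl_N`. -/
noncomputable def fieldOp (i : Fin N) (f : Localization.Away h) :
    Module.End K (Localization.Away h ⊗[K] U) :=
  f • covDer c B i + (gradOp c U i f).restrictScalars K

theorem fieldOp_apply (i : Fin N) (f : Localization.Away h) (y : Localization.Away h ⊗[K] U) :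
    fieldOp c B i f y = f • covDer c B i y + gradOp c U i f y := rfl

theorem gradOp_apply (i : Fin N) (f : Localization.Away h) (y : Localization.Away h ⊗[K] U) :
    gradOp c U i f y = ∑ p, c.der p f • unitTensor h U p i y := by
  simp [gradOp]

theorem gradOp_mul (i : Fin N) (a f : Localization.Away h) (y : Localization.Away h ⊗[K] U) :
    gradOp c U i (a * f) y = a • gradOp c U i f y + f • gradOp c U i a y := by
  simp only [gradOp_apply, Derivation.leibniz, add_smul, Finset.sum_add_distrib, Finset.smul_sum,
    smul_eq_mul, mul_smul]

theorem gradOp_t (i s : Fin N) (y : Localization.Away h ⊗[K] U) :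
    gradOp c U i (algebraMap A (Localization.Away h) (c.t s)) y = unitTensor h U s i y := by
  simp [gradOp_apply, c.der_t]

theorem fieldOp_mul (i : Fin N) (a f : Localization.Away h) (y : Localization.Away h ⊗[K] U) :
    fieldOp c B i (a * f) y = a • fieldOp c B i f y + f • gradOp c U i a y := by
  rw [fieldOp_apply, fieldOp_apply, gradOp_mul, smul_add, mul_smul, add_assoc]

theorem fieldOp_smul (i : Fin N) (f a : Localization.Away h) (y : Localization.Away h ⊗[K] U) :
    fieldOp c B i f (a • y) = a • fieldOp c B i f y + (f * c.der i a) • y := by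
  rw [fieldOp_apply, fieldOp_apply, covDer_smul, map_smul, smul_add, smul_add, mul_smul,
    smul_comm f a]
  abel

theorem fieldOp_zero (i : Fin N) (y : Localization.Away h ⊗[K] U) : fieldOp c B i 0 y = 0 := by
  simp [fieldOp_apply, gradOp_apply]

/-- The identity `quadratic_identity` for the operators of a tensor module. -/
theorem fieldOp_quadratic (i j : Fin N) (a b f g : Localization.Away h)
    (y : Localization.Away h ⊗[K] U) :
    fieldOp c B i (a * (b * f)) (fieldOp c B j g y) -
        fieldOp c B i (a * f) (fieldOp c B j (b * g) y) -
        fieldOp c B i (b * f) (fieldOp c B j (a * g) y) +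
        fieldOp c B i f (fieldOp c B j (a * (b * g)) y) =
      (f * g) • (c.der i a • gradOp c U j b y + c.der i b • gradOp c U j a y -
        gradOp c U i a (gradOp c U j b y) - gradOp c U i b (gradOp c U j a y)) := by
  exact quadratic_identity (X := fun f => (fieldOp c B i f).toAddMonoidHom)
    (X' := fun f => fieldOp c B j f) (G := gradOp c U i) (G' := fun f => gradOp c U j f)
    (δ := c.der i) (fun a b => (c.der i).leibniz a b) (fieldOp_mul c B i) (fieldOp_mul c B j)
    (fieldOp_smul c B i) a b f g y

theorem iterDer_single (p : Fin N) (f : Localization.Away h) :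
    c.iterDer (Finsupp.single p 1) f = c.der p f := by
  have key : ∀ (n : ℕ) (k : Fin n → ℕ) (x : Module.End K (Localization.Away h)),
      (List.ofFn fun i => x ^ k i).prod = x ^ ∑ i, k i := by
    intro n k x
    induction n with
    | zero => simp
    | succ n ih => rw [List.ofFn_succ, List.prod_cons, ih, Fin.sum_univ_succ, pow_add]
  have h1 : (fun i : Fin N => ((c.der i : Module.End K (Localization.Away h)) ^
      (Finsupp.single p 1 : Fin N →₀ ℕ) i)) =
      fun i => (c.der p : Module.End K (Localization.Away h)) ^
        (Finsupp.single p 1 : Fin N →₀ ℕ) i := by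
    funext i
    rcases eq_or_ne i p with rfl | hi
    · rfl
    · simp [hi.symm]
  rw [ChartParameters.iterDer, h1, key]
  simp [Finsupp.single_apply]

theorem linearPart_mono_apply (k : {k : Fin N →₀ ℕ // k ≠ 0}) (i q j : Fin N) :
    linearPart K N (LPlus.mono k i) q j = MvPolynomial.constantCoeff (MvPolynomial.pderiv q
      (MvPolynomial.monomial k.1 (1 : K) * MvPolynomial.pderiv i (MvPolynomial.X j))) := rfl

theorem inflate_mono (k : {k : Fin N →₀ ℕ // k ≠ 0}) (i : Fin N) :
    inflate K N U (LPlus.mono k i) =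
      ∑ p, if k.1 = Finsupp.single p 1 then unitAction K U p i else 0 := by
  have h1 : linearPart K N (LPlus.mono k i) =
      ∑ p, if k.1 = Finsupp.single p 1 then Matrix.single p i (1 : K) else 0 := by
    ext q j
    have h2 : ∀ p : Fin N, (if k.1 = Finsupp.single p 1 then Matrix.single p i (1 : K) else 0) q j =
        if p = q then (if k.1 = Finsupp.single q 1 ∧ i = j then 1 else 0) else 0 := by
      intro p
      by_cases hp : p = q
      · subst hp
        by_cases hk : k.1 = Finsupp.single p 1 <;> simp [hk, Matrix.single_apply]
      · by_cases hk : k.1 = Finsupp.single p 1 <;> simp [hk, hp]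
    rw [Matrix.sum_apply]
    simp only [h2, Finset.sum_ite_eq', Finset.mem_univ, if_true]
    rw [linearPart_mono_apply]
    rcases eq_or_ne i j with rfl | hij
    · rw [MvPolynomial.pderiv_X_self, mul_one, MvPolynomial.constantCoeff_eq,
        MvPolynomial.coeff_pderiv, MvPolynomial.coeff_monomial]
      simp
    · rw [MvPolynomial.pderiv_X_of_ne hij.symm]
      simp [hij]
  change LieModule.toEnd K (Matrix (Fin N) (Fin N) K) U (linearPart K N (LPlus.mono k i)) = _
  rw [h1, map_sum]
  refine Finset.sum_congr rfl fun p _ => ?_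
  split_ifs
  · rfl
  · rw [map_zero]

/-- When `L₊` acts through `gl_N`, only the terms with `|k| = 1` contribute to the action. -/
theorem gaugeAction_inflate (η : Derivation K A A) (y : Localization.Away h ⊗[K] U) :
    gaugeAction c (inflate K N U) B η y =
      ∑ i, fieldOp c B i (algebraMap A (Localization.Away h) (η (c.t i))) y := by
  have hmap : ∀ (a : Localization.Away h) (φ : Module.End K U) (y : Localization.Away h ⊗[K] U),
      TensorProduct.map (LinearMap.mulLeft K a) φ y =
        a • φ.baseChange (Localization.Away h) y := by
    intro a φ y
    induction y with
    | zero => simp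
    | tmul f u => simp [TensorProduct.smul_tmul']
    | add y z hy hz => simp only [map_add, smul_add, hy, hz]
  have hsum : ∀ (i : Fin N) (f : Localization.Away h),
      (∑ᶠ k : {k : Fin N →₀ ℕ // k ≠ 0}, ((∏ p, ((k.1 p).factorial : K))⁻¹) •
        TensorProduct.map (LinearMap.mulLeft K (c.iterDer k.1 f))
          (inflate K N U (LPlus.mono k i)) : Module.End K (Localization.Away h ⊗[K] U)) =
      ∑ p, TensorProduct.map (LinearMap.mulLeft K (c.der p f)) (unitAction K U p i) := by
    intro i f
    let e : Fin N → {k : Fin N →₀ ℕ // k ≠ 0} := fun p => ⟨Finsupp.single p 1, by simp⟩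
    have he : Function.Injective e := fun p q hpq =>
      Finsupp.single_left_injective one_ne_zero (congrArg Subtype.val hpq)
    have hinfl : ∀ p, inflate K N U (LPlus.mono (e p) i) = unitAction K U p i := by
      intro p
      rw [inflate_mono, Finset.sum_eq_single p]
      · simp [e]
      · intro q _ hq
        rw [if_neg]
        exact fun h => hq (Finsupp.single_left_injective one_ne_zero h).symm
      · simp
    rw [finsum_eq_sum_of_support_subset (s := Finset.univ.map ⟨e, he⟩)]
    · rw [Finset.sum_map]
      refine Finset.sum_congr rfl fun p _ => ?_
      simp only [Function.Embedding.coeFn_mk, hinfl]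
      have h1 : (∏ q, (((e p).1 q).factorial : K)) = 1 := by
        refine Finset.prod_eq_one fun q _ => ?_
        by_cases hq : p = q <;> simp [e, hq]
      rw [h1, inv_one, one_smul]
      simp only [e, iterDer_single]
    · intro k hk
      by_contra hk'
      refine hk ?_
      have h1 : inflate K N U (LPlus.mono k i) = 0 := by
        rw [inflate_mono]
        refine Finset.sum_eq_zero fun p _ => if_neg fun h => hk' ?_
        simp only [Finset.coe_map, Finset.coe_univ, Set.image_univ, Set.mem_range,
          Function.Embedding.coeFn_mk]
        exact ⟨p, Subtype.ext h.symm⟩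
      simp only [h1, TensorProduct.map_zero_right, smul_zero]
  rw [gaugeAction]
  simp only [hsum, LinearMap.add_apply, LinearMap.sum_apply, hmap, ← Finset.sum_add_distrib]
  refine Finset.sum_congr rfl fun i _ => ?_
  rw [fieldOp_apply, gradOp_apply]
  rfl

/-- A derivation of `A` that restricts `f ∂/∂t_i` acts as the operator `fieldOp`. -/
theorem gaugeAction_inflate_of_eq {η : Derivation K A A} {i : Fin N} {f : Localization.Away h}
    (hη : ∀ x, algebraMap A (Localization.Away h) (η x) =
      f * c.der i (algebraMap A (Localization.Away h) x)) (y : Localization.Away h ⊗[K] U) :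
    gaugeAction c (inflate K N U) B η y = fieldOp c B i f y := by
  rw [gaugeAction_inflate, Finset.sum_eq_single i]
  · rw [hη, c.der_t, if_pos rfl, mul_one]
  · intro j _ hj
    rw [hη, c.der_t, if_neg hj.symm, mul_zero, fieldOp_zero]
  · simp

end TensorModule

/-! ### Simplicity of gauge modules -/

section Tensor

variable {K : Type u} [Field K] {R : Type v} [CommRing R] [Algebra K R]
  {U : Type w} [AddCommGroup U] [Module K U] [FiniteDimensional K U]

theorem exists_dual_rTensor_ne_zero {y : R ⊗[K] U} (hy : y ≠ 0) :
    ∃ θ : R →ₗ[K] K, LinearMap.rTensor U θ y ≠ 0 := by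
  let b := (Module.finBasis K U).baseChange R
  obtain ⟨i, hi⟩ : ∃ i, b.repr y i ≠ 0 := by
    by_contra! h
    exact hy (b.repr.map_eq_zero_iff.mp (Finsupp.ext h))
  obtain ⟨θ, hθ⟩ : ∃ θ : R →ₗ[K] K, θ (b.repr y i) ≠ 0 := by
    by_contra! h
    exact hi ((Module.forall_dual_apply_eq_zero_iff K _).mp h)
  refine ⟨θ, fun h => hθ ?_⟩
  have key : ∀ z : R ⊗[K] U, θ (b.repr z i) =
      TensorProduct.lid K K (LinearMap.lTensor K ((Module.finBasis K U).coord i)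
        (LinearMap.rTensor U θ z)) := by
    intro z
    induction z with
    | zero => simp
    | tmul f u => simp [b, mul_comm]
    | add y z hy hz => simp only [map_add, Finsupp.add_apply, hy, hz]
  rw [key, h, map_zero, map_zero]

/-- A non-zero `R`-submodule of `R ⊗ U` stable under all endomorphisms of `U` contains `f ⊗ U` for
some non-zero `f`. -/
theorem exists_ne_zero_tmul_mem {W : Submodule R (R ⊗[K] U)} (hne : W ≠ ⊥)
    (hW : ∀ φ : Module.End K U, ∀ y ∈ W, φ.baseChange R y ∈ W) :
    ∃ f : R, f ≠ 0 ∧ ∀ u : U, f ⊗ₜ[K] u ∈ W := by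
  let b := (Module.finBasis K U).baseChange R
  obtain ⟨y, hyW, hy⟩ := W.ne_bot_iff.mp hne
  obtain ⟨i, hi⟩ : ∃ i, b.repr y i ≠ 0 := by
    by_contra! h
    exact hy (b.repr.map_eq_zero_iff.mp (Finsupp.ext h))
  refine ⟨b.repr y i, hi, fun u => ?_⟩
  have key : ∀ z : R ⊗[K] U, b.repr z i ⊗ₜ[K] u =
      LinearMap.baseChange R (((Module.finBasis K U).coord i).smulRight u) z := by
    intro z
    induction z with
    | zero => simp
    | tmul f v => simp [b, TensorProduct.smul_tmul]
    | add y z hy hz => simp only [map_add, Finsupp.add_apply, TensorProduct.add_tmul, hy, hz]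
  rw [key]
  exact hW _ y hyW

end Tensor

section Simple

variable {K : Type u} [Field K] {A : Type v} [CommRing A] [Algebra K A] {h : A} {N : ℕ}
  (c : ChartParameters K h N) {U : Type w} [AddCommGroup U] [Module K U]
  [LieRingModule (Matrix (Fin N) (Fin N) K) U] [LieModule K (Matrix (Fin N) (Fin N) K) U]
  (B : Fin N → Module.End (Localization.Away h) (Localization.Away h ⊗[K] U))

/-- For simple `U`, the only submodules of `A_(h) ⊗ U` stable under `gl_N` and the covariant
derivatives are the trivial ones. -/
theorem eq_top_of_unitTensor_mem [CharZero K] [IsAlgClosed K] [FiniteDimensional K U]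
    [LieModule.IsIrreducible K (Matrix (Fin N) (Fin N) K) U] [IsDomain A] (hh : h ≠ 0)
    {W : Submodule (Localization.Away h) (Localization.Away h ⊗[K] U)} (hne : W ≠ ⊥)
    (hE : ∀ p i : Fin N, ∀ y ∈ W, unitTensor h U p i y ∈ W)
    (hD : ∀ i, ∀ y ∈ W, covDer c B i y ∈ W) : W = ⊤ := by
  have hend : ∀ φ : Module.End K U, ∀ y ∈ W, φ.baseChange (Localization.Away h) y ∈ W := by
    intro φ
    have hφ : φ ∈ Algebra.adjoin K {f | ∃ a b, f = unitAction K (N := N) U a b} := by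
      rw [adjoin_unitAction_eq_top]; trivial
    induction hφ using Algebra.adjoin_induction with
    | mem f hf => obtain ⟨a, b, rfl⟩ := hf; exact hE a b
    | algebraMap r =>
      intro y hy
      have : ((algebraMap K (Module.End K U) r).baseChange (Localization.Away h)) y =
          algebraMap K (Localization.Away h) r • y := by
        rw [Module.algebraMap_end_eq_smul_id, LinearMap.baseChange_smul, LinearMap.baseChange_id,
          algebraMap_smul]
        rfl
      rw [this]
      exact W.smul_mem _ hy
    | add f g _ _ hf hg =>
      intro y hy
      rw [LinearMap.baseChange_add]
      exact add_mem (hf y hy) (hg y hy)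
    | mul f g _ _ hf hg =>
      intro y hy
      rw [LinearMap.baseChange_mul]
      exact hf _ (hg y hy)
  obtain ⟨f, hf0, hf⟩ := exists_ne_zero_tmul_mem hne hend
  -- The ideal of all `f` with `f ⊗ U ⊆ W` is non-zero and stable under the derivations.
  let J : Ideal (Localization.Away h) :=
    { carrier := {f | ∀ u : U, f ⊗ₜ[K] u ∈ W}
      add_mem' := fun ha hb u => by rw [TensorProduct.add_tmul]; exact add_mem (ha u) (hb u)
      zero_mem' := fun u => by rw [TensorProduct.zero_tmul]; exact zero_mem _
      smul_mem' := fun a f hf u => by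
        rw [← TensorProduct.smul_tmul']; exact W.smul_mem a (hf u) }
  have hJsmul : ∀ f ∈ J, ∀ y : Localization.Away h ⊗[K] U, f • y ∈ W := by
    intro f hf y
    induction y with
    | zero => rw [smul_zero]; exact zero_mem _
    | tmul a u =>
      have : f • (a ⊗ₜ[K] u) = a • (f ⊗ₜ[K] u) := by
        rw [TensorProduct.smul_tmul', TensorProduct.smul_tmul', smul_eq_mul, smul_eq_mul, mul_comm]
      rw [this]
      exact W.smul_mem a (hf u)
    | add y z hy hz => rw [smul_add]; exact add_mem hy hz
  have hJ : J = ⊤ := by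
    refine c.eq_top_of_der_mem hh (fun i f hf u => ?_) (J.ne_bot_iff.mpr ⟨f, hf, hf0⟩)
    have h1 : covDer c B i (f ⊗ₜ[K] u) = c.der i f ⊗ₜ[K] u + f • B i (1 ⊗ₜ[K] u) := by
      rw [← map_smul, TensorProduct.smul_tmul', smul_eq_mul, mul_one]
      rfl
    rw [eq_sub_of_add_eq h1.symm]
    exact sub_mem (hD i _ (hf u)) (hJsmul f hf _)
  rw [eq_top_iff]
  intro y _
  rw [← one_smul (Localization.Away h) y]
  exact hJsmul 1 (hJ ▸ Submodule.mem_top) y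

variable {M : Type*} [AddCommGroup M] [Module A M] [LieRingModule (Derivation K A A) M]

/-- A non-zero `AV`-submodule of a local gauge module with simple `U` contains a multiple of the
whole module by a power of `h`. -/
theorem exists_pow_smul_mem [CharZero K] [IsAlgClosed K] [FiniteDimensional K U]
    [LieModule.IsIrreducible K (Matrix (Fin N) (Fin N) K) U] [IsDomain A]
    [Algebra.FiniteType K A] (hh : h ≠ 0) [Module.Finite A M]
    (ι : M →ₗ[A] Localization.Away h ⊗[K] U) (hι : Function.Injective ι)
    (hact : ∀ (η : Derivation K A A) (m : M),
      ι ⁅η, m⁆ = gaugeAction c (inflate K N U) B η (ι m))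
    {W : Submodule A M} (hW : ∀ (η : Derivation K A A), ∀ m ∈ W, ⁅η, m⁆ ∈ W) (hne : W ≠ ⊥) :
    ∃ k : ℕ, ∀ m : M, h ^ k • m ∈ W := by
  set ψ := algebraMap A (Localization.Away h) with hψ
  obtain ⟨s, hs⟩ := c.exists_lift hh
  choose d hd using hs
  have hunit : IsUnit (ψ (h ^ s)) :=
    IsLocalization.map_units _ (⟨h ^ s, s, rfl⟩ : Submonoid.powers h)
  have hd' : ∀ i a m, ι ⁅d i a, m⁆ = fieldOp c B i (ψ a * ψ (h ^ s)) (ι m) := by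
    intro i a m
    rw [hact]
    exact gaugeAction_inflate_of_eq c B (fun x => by rw [hd, ← hψ, map_mul]) _
  let Wh : Submodule (Localization.Away h) (Localization.Away h ⊗[K] U) :=
    Submodule.span _ (ι '' W)
  have hιW : ∀ m ∈ W, ι m ∈ Wh := fun m hm => Submodule.subset_span ⟨m, hm, rfl⟩
  have hψsmul : ∀ (a : A) (y : Localization.Away h ⊗[K] U), ψ a • y = a • y := fun a y =>
    algebraMap_smul _ a y
  have hcancel : ∀ y : Localization.Away h ⊗[K] U, ψ (h ^ s) • y ∈ Wh → y ∈ Wh := by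
    intro y hy
    have := Wh.smul_mem (↑hunit.unit⁻¹ : Localization.Away h) hy
    rwa [smul_smul, IsUnit.val_inv_mul, one_smul] at this
  have hE : ∀ p i : Fin N, ∀ y ∈ Wh, unitTensor h U p i y ∈ Wh := by
    intro p i y hy
    induction hy using Submodule.span_induction with
    | mem y hy =>
      obtain ⟨m, hm, rfl⟩ := hy
      apply hcancel
      have h1 : ψ (h ^ s) • unitTensor h U p i (ι m) =
          ι ⁅d i (c.t p), m⁆ - ψ (c.t p) • ι ⁅d i 1, m⁆ := by
        rw [hd', hd', fieldOp_mul, hψ, gradOp_t, map_one, one_mul, add_sub_cancel_left]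
      rw [h1]
      exact sub_mem (hιW _ (hW _ m hm)) (Wh.smul_mem _ (hιW _ (hW _ m hm)))
    | zero => rw [map_zero]; exact zero_mem _
    | add y z _ _ hy hz => rw [map_add]; exact add_mem hy hz
    | smul a y _ hy => rw [map_smul]; exact Wh.smul_mem a hy
  have hD : ∀ i, ∀ y ∈ Wh, covDer c B i y ∈ Wh := by
    intro i y hy
    induction hy using Submodule.span_induction with
    | mem y hy =>
      obtain ⟨m, hm, rfl⟩ := hy
      apply hcancel
      have h1 : ψ (h ^ s) • covDer c B i (ι m) =
          ι ⁅d i 1, m⁆ - gradOp c U i (ψ (h ^ s)) (ι m) := by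
        rw [hd', map_one, one_mul, fieldOp_apply, add_sub_cancel_right]
      rw [h1, gradOp_apply]
      exact sub_mem (hιW _ (hW _ m hm))
        (sum_mem fun p _ => Wh.smul_mem _ (hE p i _ (hιW m hm)))
    | zero => rw [map_zero]; exact zero_mem _
    | add y z _ _ hy hz => rw [map_add]; exact add_mem hy hz
    | smul a y hy' hy =>
      rw [covDer_smul]
      exact add_mem (Wh.smul_mem _ hy') (Wh.smul_mem _ hy)
  have hWh : Wh ≠ ⊥ := by
    obtain ⟨m, hm, hm0⟩ := W.ne_bot_iff.mp hne
    exact Wh.ne_bot_iff.mpr ⟨ι m, hιW m hm, fun h => hm0 (hι (h.trans (map_zero ι).symm))⟩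
  have htop := eq_top_of_unitTensor_mem c B hh hWh hE hD
  have hmem : ∀ y ∈ Wh, ∃ k : ℕ, ∃ m ∈ W, h ^ k • y = ι m := by
    intro y hy
    induction hy using Submodule.span_induction with
    | mem y hy => obtain ⟨m, hm, rfl⟩ := hy; exact ⟨0, m, hm, by simp⟩
    | zero => exact ⟨0, 0, zero_mem _, by simp⟩
    | add y z _ _ hy hz =>
      obtain ⟨k, m, hm, hk⟩ := hy
      obtain ⟨l, m', hm', hl⟩ := hz
      refine ⟨k + l, h ^ l • m + h ^ k • m',
        add_mem (W.smul_mem _ hm) (W.smul_mem _ hm'), ?_⟩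
      rw [map_add, map_smul, map_smul, ← hk, ← hl, smul_smul, smul_smul, smul_add, pow_add,
        mul_comm (h ^ l)]
    | smul a y _ hy =>
      obtain ⟨k, m, hm, hk⟩ := hy
      obtain ⟨⟨x, ⟨_, l, rfl⟩⟩, hx⟩ := IsLocalization.surj (Submonoid.powers h) a
      refine ⟨l + k, x • m, W.smul_mem _ hm, ?_⟩
      rw [map_smul, ← hk, ← hψsmul x, ← hψsmul (h ^ k), ← hψsmul (h ^ (l + k)), smul_smul,
        smul_smul, pow_add, map_mul]
      congr 1
      rw [← hx]
      ring
  obtain ⟨S, hS⟩ := (inferInstance : Module.Finite A M).fg_top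
  have hm : ∀ m : M, ∃ k : ℕ, h ^ k • m ∈ W := by
    intro m
    obtain ⟨k, m', hm', hk⟩ := hmem (ι m) (htop ▸ Submodule.mem_top)
    rw [← map_smul] at hk
    exact ⟨k, hι hk ▸ hm'⟩
  choose k hk using hm
  refine ⟨S.sup k, fun m => ?_⟩
  have hmS : m ∈ Submodule.span A (S : Set M) := hS ▸ Submodule.mem_top
  induction hmS using Submodule.span_induction with
  | mem m hm =>
    rw [← Nat.sub_add_cancel (Finset.le_sup (f := k) hm), pow_add, mul_smul]
    exact W.smul_mem _ (hk m)
  | zero => rw [smul_zero]; exact zero_mem _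
  | add y z _ _ hy hz => rw [smul_add]; exact add_mem hy hz
  | smul a y _ hy => rw [smul_comm]; exact W.smul_mem a hy

/-- A non-zero submodule over the vector fields alone contains a non-zero `AV`-submodule, unless
the quadratic relations of the fermionic modules have a non-zero solution in `U`. -/
theorem exists_ne_zero_forall_smul_mem [FiniteDimensional K U] [IsDomain A]
    [Algebra.FiniteType K A] (hh : h ≠ 0) [Module K M] [IsScalarTower K A M]
    [LieModule K (Derivation K A A) M]
    (ι : M →ₗ[A] Localization.Away h ⊗[K] U) (hι : Function.Injective ι)
    (hact : ∀ (η : Derivation K A A) (m : M),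
      ι ⁅η, m⁆ = gaugeAction c (inflate K N U) B η (ι m))
    {W : LieSubmodule K (Derivation K A A) M} (hne : W ≠ ⊥) :
    (∃ m : M, m ≠ 0 ∧ ∀ a : A, a • m ∈ W) ∨
    ∃ y : U, y ≠ 0 ∧ ∀ s i r j : Fin N, unitAction K U s i (unitAction K U r j y) +
      unitAction K U r i (unitAction K U s j y) =
      (if i = s then unitAction K U r j y else 0) +
        (if i = r then unitAction K U s j y else 0) := by
  set ψ := algebraMap A (Localization.Away h) with hψ
  obtain ⟨e, he⟩ := c.exists_lift hh
  choose d hd using he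
  have hunit : IsUnit (ψ (h ^ e)) :=
    IsLocalization.map_units _ (⟨h ^ e, e, rfl⟩ : Submonoid.powers h)
  have hd' : ∀ i a m, ι ⁅d i a, m⁆ = fieldOp c B i (ψ a * ψ (h ^ e)) (ι m) := by
    intro i a m
    rw [hact]
    exact gaugeAction_inflate_of_eq c B (fun x => by rw [hd, ← hψ, map_mul]) _
  refine or_iff_not_imp_left.mpr fun hno => ?_
  push Not at hno
  obtain ⟨w, hwW, hw0⟩ : ∃ w ∈ W, w ≠ 0 := by
    by_contra! h
    exact hne ((LieSubmodule.eq_bot_iff W).mpr h)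
  let q : (Fin N → Fin N → Fin N → Fin N → Module.End K U) := fun s i r j =>
    (if i = s then unitAction K U r j else 0) + (if i = r then unitAction K U s j else 0) -
      unitAction K U s i * unitAction K U r j - unitAction K U r i * unitAction K U s j
  have hite : ∀ (p : Prop) [Decidable p] (φ : Module.End K U) (y : Localization.Away h ⊗[K] U),
      (if p then φ else 0).baseChange (Localization.Away h) y =
        (if p then (1 : Localization.Away h) else 0) • φ.baseChange (Localization.Away h) y := by
    intro p _ φ y
    split_ifs <;> simp
  have hq : ∀ s i r j, (q s i r j).baseChange (Localization.Away h) (ι w) = 0 := by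
    intro s i r j
    -- The second difference of `quadratic_identity`, with `t_s` and `t_r` as the multipliers and
    -- an additional factor `a` in the second vector field. It is `A`-linear in `a`.
    let x : A → M := fun a => ⁅d i (c.t s * c.t r), ⁅d j a, w⁆⁆ -
      ⁅d i (c.t s), ⁅d j (c.t r * a), w⁆⁆ - ⁅d i (c.t r), ⁅d j (c.t s * a), w⁆⁆ +
      ⁅d i 1, ⁅d j (c.t s * (c.t r * a)), w⁆⁆
    have hxW : ∀ a, x a ∈ W := fun a =>
      add_mem (sub_mem (sub_mem (W.lie_mem (W.lie_mem hwW)) (W.lie_mem (W.lie_mem hwW)))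
        (W.lie_mem (W.lie_mem hwW))) (W.lie_mem (W.lie_mem hwW))
    have hx : ∀ a, ι (x a) = (ψ (h ^ e) * (ψ a * ψ (h ^ e))) •
        (q s i r j).baseChange (Localization.Away h) (ι w) := by
      intro a
      have h1 := fieldOp_quadratic c B i j (ψ (c.t s)) (ψ (c.t r)) (ψ (h ^ e))
        (ψ a * ψ (h ^ e)) (ι w)
      simp only [x, map_add, map_sub, hd', map_mul, map_one, one_mul, mul_assoc] at h1 ⊢
      rw [h1]
      congr 1
      simp only [q, hψ, gradOp_t, c.der_t, LinearMap.baseChange_sub, LinearMap.baseChange_add,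
        LinearMap.baseChange_mul, LinearMap.sub_apply, LinearMap.add_apply, hite]
      rfl
    have hx1 : x 1 = 0 := by
      by_contra hx0
      obtain ⟨a, ha⟩ := hno (x 1) hx0
      refine ha ?_
      have : x a = a • x 1 := by
        apply hι
        rw [map_smul, hx, hx, ← algebraMap_smul (Localization.Away h) a, smul_smul, map_one,
          one_mul, mul_left_comm]
      rw [← this]
      exact hxW a
    have h2 := hx 1
    rw [hx1, map_zero, map_one, one_mul] at h2
    exact ((hunit.mul hunit).smul_eq_zero.mp h2.symm)
  obtain ⟨θ, hθ⟩ := exists_dual_rTensor_ne_zero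
    (fun h => hw0 (hι (h.trans (map_zero ι).symm)) : ι w ≠ 0)
  refine ⟨TensorProduct.lid K U (LinearMap.rTensor U θ (ι w)),
    fun h => hθ ((TensorProduct.lid K U).map_eq_zero_iff.mp h), fun s i r j => ?_⟩
  have key : ∀ (φ : Module.End K U) (y : Localization.Away h ⊗[K] U),
      φ (TensorProduct.lid K U (LinearMap.rTensor U θ y)) =
        TensorProduct.lid K U
          (LinearMap.rTensor U θ (φ.baseChange (Localization.Away h) y)) := by
    intro φ y
    induction y with
    | zero => simp
    | tmul f u => simp
    | add y z hy hz => simp only [map_add, hy, hz]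
  have h3 := key (q s i r j) (ι w)
  rw [hq, map_zero, map_zero] at h3
  simp only [q, LinearMap.sub_apply, LinearMap.add_apply, Module.End.mul_apply] at h3
  rw [sub_sub, sub_eq_zero] at h3
  rw [← h3]
  split_ifs <;> rfl

end Simple

/-- Gauge modules built from a simple `gl_N`-module that is not an exterior power are simple over
the vector fields. -/
theorem IsGaugeModule.isIrreducible {K : Type u} [Field K] [IsAlgClosed K] [CharZero K]
    {n m N r : ℕ} {g : Fin m → MvPolynomial (Fin n) K} (hg : IsSmoothIrreducible g N)
    {U : Type v} [AddCommGroup U] [Module K U] [FiniteDimensional K U]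
    [LieRingModule (Matrix (Fin N) (Fin N) K) U] [LieModule K (Matrix (Fin N) (Fin N) K) U]
    [LieModule.IsIrreducible K (Matrix (Fin N) (Fin N) K) U]
    (hU : ∀ k ≤ N, ¬ Nonempty (U ≃ₗ⁅K, Matrix (Fin N) (Fin N) K⁆ ⋀[K]^k (Fin N → K)))
    {M : Type w} [AddCommGroup M] [Module K M] [Module (CoordRing g) M]
    [IsScalarTower K (CoordRing g) M]
    [LieRingModule (Derivation K (CoordRing g) (CoordRing g)) M]
    [LieModule K (Derivation K (CoordRing g) (CoordRing g)) M] [Nontrivial M]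
    (hM : IsGaugeModule g N M) {rows : Fin r → Fin m} {cols : Fin r → Fin n}
    (hminor : jacobianMinor g rows cols ≠ 0)
    (c : ChartParameters K (jacobianMinor g rows cols) N)
    (B : Fin N → Module.End (Localization.Away (jacobianMinor g rows cols))
      (Localization.Away (jacobianMinor g rows cols) ⊗[K] U))
    (hloc : IsLocalGaugeModule c (inflate K N U) B M) :
    LieModule.IsIrreducible K (Derivation K (CoordRing g) (CoordRing g)) M := by
  have hprime := hg.isPrime
  have hdom : IsDomain (CoordRing g) := inferInstance
  obtain ⟨hfin, ι, hι, hact⟩ := hloc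
  refine LieModule.IsIrreducible.mk fun W hW => ?_
  rcases exists_ne_zero_forall_smul_mem c B hminor ι hι hact hW with ⟨w, hw0, hw⟩ | ⟨y, hy0, hy⟩
  -- In the first case, `W'` is the largest `AV`-submodule contained in `W`, and `I` is the
  -- annihilator of `M / W'`.
  · let W' : Submodule (CoordRing g) M :=
      { carrier := {m | ∀ a : CoordRing g, a • m ∈ W}
        add_mem' := fun hx hy a => by rw [smul_add]; exact add_mem (hx a) (hy a)
        zero_mem' := fun a => by rw [smul_zero]; exact zero_mem _
        smul_mem' := fun b m hm a => by rw [smul_smul]; exact hm _ }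
    have hW' : ∀ (η : Derivation K (CoordRing g) (CoordRing g)), ∀ m ∈ W', ⁅η, m⁆ ∈ W' := by
      intro η m hm a
      have h1 := hM.1 η a m
      rw [eq_sub_of_add_eq' h1.symm]
      exact sub_mem (W.lie_mem (hm a)) (hm _)
    have hne : W' ≠ ⊥ := W'.ne_bot_iff.mpr ⟨w, hw, hw0⟩
    obtain ⟨k, hk⟩ := exists_pow_smul_mem c B hminor ι hι hact hW' hne
    let I : Ideal (CoordRing g) :=
      ⨅ m : M, W'.comap (LinearMap.toSpanSingleton (CoordRing g) M m)
    have hmemI : ∀ a, a ∈ I ↔ ∀ m : M, a • m ∈ W' := fun a => by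
      simp only [I, Submodule.mem_iInf, Submodule.mem_comap, LinearMap.toSpanSingleton_apply]
    have hI : ∀ η : Derivation K (CoordRing g) (CoordRing g), ∀ f ∈ I, η f ∈ I := by
      intro η f hf
      rw [hmemI] at hf ⊢
      intro m
      rw [eq_sub_of_add_eq (hM.1 η f m).symm]
      exact sub_mem (hW' η _ (hf m)) (hf _)
    have hI0 : I ≠ ⊥ := I.ne_bot_iff.mpr ⟨_, (hmemI _).mpr hk, pow_ne_zero k hminor⟩
    have htop : I = ⊤ := hg.eq_top fun r' rows' cols' hr' hminor' => by
      obtain ⟨c', -⟩ := hM.2 r' rows' cols' hr' hminor'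
      exact c'.exists_pow_mem hminor' hI hI0
    rw [eq_top_iff]
    intro m _
    have h1 : (1 : CoordRing g) ∈ I := htop ▸ Submodule.mem_top
    have h2 := (hmemI 1).mp h1 m 1
    rwa [one_smul, one_smul] at h2
  · obtain ⟨k, hk, e⟩ := exists_equiv_exteriorPower (isFermionic_of_ne_zero hy0 hy)
    exact absurd e (hU k hk)

/-! ### Vector fields act by a Lie algebra representation -/

section LieAction

variable {K : Type u} [Field K] {A : Type v} [CommRing A] [Algebra K A] {h : A} {N : ℕ}
  (c : ChartParameters K h N) {U : Type w} [AddCommGroup U] [Module K U]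
  [LieRingModule (Matrix (Fin N) (Fin N) K) U] [LieModule K (Matrix (Fin N) (Fin N) K) U]
  (B : Fin N → Module.End (Localization.Away h) (Localization.Away h ⊗[K] U))

theorem unitTensor_comm (a b p q : Fin N) (y : Localization.Away h ⊗[K] U) :
    unitTensor h U a b (unitTensor h U p q y) - unitTensor h U p q (unitTensor h U a b y) =
      (if b = p then unitTensor h U a q y else 0) -
        (if q = a then unitTensor h U p b y else 0) := by
  induction y with
  | zero => simp
  | tmul f u =>
    simp only [unitTensor_tmul, ← TensorProduct.tmul_sub, unitAction_comm]
    split_ifs <;> simp [TensorProduct.tmul_sub, TensorProduct.tmul_neg]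
  | add y z hy hz =>
    simp only [map_add, add_sub_add_comm, hy, hz]
    split_ifs <;> abel

theorem gradOp_comm (i j : Fin N) (f g : Localization.Away h) (y : Localization.Away h ⊗[K] U) :
    gradOp c U i f (gradOp c U j g y) - gradOp c U j g (gradOp c U i f y) =
      c.der i g • gradOp c U j f y - c.der j f • gradOp c U i g y := by
  have h1 : gradOp c U i f (gradOp c U j g y) - gradOp c U j g (gradOp c U i f y) =
      ∑ p, ∑ q, (c.der p f * c.der q g) • (unitTensor h U p i (unitTensor h U q j y) -
        unitTensor h U q j (unitTensor h U p i y)) := by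
    simp only [gradOp_apply, map_sum, map_smul, Finset.smul_sum, smul_sub, mul_smul,
      Finset.sum_sub_distrib]
    congr 1
    rw [Finset.sum_comm]
    refine Finset.sum_congr rfl fun p _ => Finset.sum_congr rfl fun q _ => smul_comm _ _ _
  rw [h1]
  simp only [unitTensor_comm, smul_sub, Finset.sum_sub_distrib, smul_ite, smul_zero]
  congr 1
  · simp only [Finset.sum_ite_eq, Finset.mem_univ, if_true, gradOp_apply, Finset.smul_sum,
      smul_smul, mul_comm (c.der i g)]
  · rw [Finset.sum_comm]
    simp only [Finset.sum_ite_eq, Finset.mem_univ, if_true, gradOp_apply, Finset.smul_sum,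
      smul_smul]

variable {B}

theorem covDer_unitTensor (hB : IsGaugeField c (inflate K N U) B) (i p j : Fin N)
    (y : Localization.Away h ⊗[K] U) :
    covDer c B i (unitTensor h U p j y) = unitTensor h U p j (covDer c B i y) := by
  have h1 : ∀ y, B i (unitTensor h U p j y) = unitTensor h U p j (B i y) := by
    intro y
    have h2 := hB.commute_rho i (LPlus.mono ⟨Finsupp.single p 1, by simp⟩ j) y
    have h3 : inflate K N U (LPlus.mono ⟨Finsupp.single p 1, by simp⟩ j) = unitAction K U p j := by
      rw [inflate_mono, Finset.sum_eq_single p]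
      · simp
      · intro q _ hq
        rw [if_neg]
        exact fun h => hq (Finsupp.single_left_injective one_ne_zero h).symm
      · simp
    rwa [h3] at h2
  have h2 : ∀ y, c.derTensor U i (unitTensor h U p j y) =
      unitTensor h U p j (c.derTensor U i y) := by
    intro y
    induction y with
    | zero => simp
    | tmul f u => simp only [unitTensor_tmul, derTensor_tmul]
    | add y z hy hz => simp only [map_add, hy, hz]
  simp only [covDer, LinearMap.add_apply, LinearMap.restrictScalars_apply, map_add, h1, h2]

omit [LieRingModule (Matrix (Fin N) (Fin N) K) U] [LieModule K (Matrix (Fin N) (Fin N) K) U] in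
theorem covDer_comm {ρ : LPlus K N →ₗ⁅K⁆ Module.End K U} (hB : IsGaugeField c ρ B) (i j : Fin N)
    (y : Localization.Away h ⊗[K] U) :
    covDer c B i (covDer c B j y) = covDer c B j (covDer c B i y) := by
  have h1 := LinearMap.congr_fun (hB.flat i j) y
  exact sub_eq_zero.mp h1

theorem fieldOp_add (i : Fin N) (f g : Localization.Away h) (y : Localization.Away h ⊗[K] U) :
    fieldOp c B i (f + g) y = fieldOp c B i f y + fieldOp c B i g y := by
  simp only [fieldOp_apply, gradOp_apply, map_add, add_smul, Finset.sum_add_distrib]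
  abel

variable (hc : ∀ i j f, c.der i (c.der j f) = c.der j (c.der i f))
include hc

theorem covDer_gradOp (hB : IsGaugeField c (inflate K N U) B) (i j : Fin N)
    (f : Localization.Away h) (y : Localization.Away h ⊗[K] U) :
    covDer c B i (gradOp c U j f y) =
      gradOp c U j (c.der i f) y + gradOp c U j f (covDer c B i y) := by
  simp only [gradOp_apply, map_sum, covDer_smul, covDer_unitTensor c hB, Finset.sum_add_distrib,
    hc i]

/-- The vector fields `f ∂/∂t_i` act as elements of the Lie algebra of vector fields. -/
theorem fieldOp_comm (hB : IsGaugeField c (inflate K N U) B) (i j : Fin N)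
    (f g : Localization.Away h) (y : Localization.Away h ⊗[K] U) :
    fieldOp c B i f (fieldOp c B j g y) - fieldOp c B j g (fieldOp c B i f y) =
      fieldOp c B j (f * c.der i g) y - fieldOp c B i (g * c.der j f) y := by
  have h1 := gradOp_comm c i j f g y
  rw [sub_eq_iff_eq_add] at h1
  simp only [fieldOp_apply, map_add, map_smul, covDer_smul, covDer_gradOp c hc hB, gradOp_mul,
    smul_add, mul_smul, covDer_comm c hB i j, h1, smul_comm f g]
  abel

/-- `hη` and `hμ` say that `η` and `μ` are the vector fields `∑ η(t_i) ∂/∂t_i` and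
`∑ μ(t_i) ∂/∂t_i`. -/
theorem gaugeAction_lie (hB : IsGaugeField c (inflate K N U) B) (η μ : Derivation K A A)
    (hη : ∀ x, algebraMap A (Localization.Away h) (η x) =
      ∑ i, algebraMap A (Localization.Away h) (η (c.t i)) *
        c.der i (algebraMap A (Localization.Away h) x))
    (hμ : ∀ x, algebraMap A (Localization.Away h) (μ x) =
      ∑ i, algebraMap A (Localization.Away h) (μ (c.t i)) *
        c.der i (algebraMap A (Localization.Away h) x)) (y : Localization.Away h ⊗[K] U) :
    gaugeAction c (inflate K N U) B ⁅η, μ⁆ y =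
      gaugeAction c (inflate K N U) B η (gaugeAction c (inflate K N U) B μ y) -
        gaugeAction c (inflate K N U) B μ (gaugeAction c (inflate K N U) B η y) := by
  have hadd : ∀ (i : Fin N) (s : Fin N → Localization.Away h),
      fieldOp c B i (∑ j, s j) y = ∑ j, fieldOp c B i (s j) y := by
    intro i s
    simp only [fieldOp_apply, gradOp_apply, map_sum, Finset.sum_smul, Finset.sum_add_distrib]
    congr 1
    exact Finset.sum_comm
  have hsub : ∀ (i : Fin N) (a b : Localization.Away h),
      fieldOp c B i (a - b) y = fieldOp c B i a y - fieldOp c B i b y := by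
    intro i a b
    have h1 := fieldOp_add c (B := B) i (a - b) b y
    rw [sub_add_cancel] at h1
    exact eq_sub_of_add_eq h1.symm
  simp only [gaugeAction_inflate, Derivation.commutator_apply, map_sub]
  have h1 : ∀ i, fieldOp c B i (algebraMap A (Localization.Away h) (η (μ (c.t i))) -
      algebraMap A (Localization.Away h) (μ (η (c.t i)))) y =
      ∑ j, (fieldOp c B i (algebraMap A (Localization.Away h) (η (c.t j)) *
        c.der j (algebraMap A (Localization.Away h) (μ (c.t i)))) y -
      fieldOp c B i (algebraMap A (Localization.Away h) (μ (c.t j)) *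
        c.der j (algebraMap A (Localization.Away h) (η (c.t i)))) y) := by
    intro i
    rw [hsub, hη (μ (c.t i)), hμ (η (c.t i)), hadd, hadd, Finset.sum_sub_distrib]
  simp only [h1, map_sum]
  rw [Finset.sum_comm (f := fun i j => fieldOp c B i (algebraMap A (Localization.Away h)
    (μ (c.t i))) (fieldOp c B j (algebraMap A (Localization.Away h) (η (c.t j))) y)),
    ← Finset.sum_sub_distrib]
  simp only [← Finset.sum_sub_distrib, fieldOp_comm c hc hB]
  simp only [Finset.sum_sub_distrib]
  congr 1
  exact Finset.sum_comm

end LieAction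

/-! ### The de Rham differential commutes with vector fields -/

section DeRham

variable {K : Type u} [Field K] {A : Type v} [CommRing A] [Algebra K A] {h : A} {N : ℕ}
  (c : ChartParameters K h N) (b : Fin N → Localization.Away h)

variable (K h) in
/-- The operator `1 ⊗ (e_p ∧ -)`. -/
noncomputable def wedgeTensor (p : Fin N) (k : ℕ) :
    Localization.Away h ⊗[K] ⋀[K]^k (Fin N → K) →ₗ[Localization.Away h]
      Localization.Away h ⊗[K] ⋀[K]^(k + 1) (Fin N → K) :=
  (wedge (Pi.single p (1 : K)) k).baseChange (Localization.Away h)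

theorem wedgeTensor_tmul (p : Fin N) (k : ℕ) (f : Localization.Away h) (v : ⋀[K]^k (Fin N → K)) :
    wedgeTensor K h p k (f ⊗ₜ v) = f ⊗ₜ wedge (Pi.single p (1 : K)) k v := rfl

theorem covDer_scalarField_tmul {U : Type w} [AddCommGroup U] [Module K U] (i : Fin N)
    (f : Localization.Away h) (u : U) :
    covDer c (scalarField K U b) i (f ⊗ₜ u) = (c.der i f + b i * f) ⊗ₜ[K] u := by
  rw [TensorProduct.add_tmul]
  rfl

theorem deRham_apply (k : ℕ) (y : Localization.Away h ⊗[K] ⋀[K]^k (Fin N → K)) :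
    deRham c b k y = ∑ p, wedgeTensor K h p k (covDer c (scalarField K _ b) p y) := by
  rw [deRham, LinearMap.sum_apply]
  refine Finset.sum_congr rfl fun p _ => ?_
  induction y with
  | zero => simp
  | tmul f v =>
    rw [covDer_scalarField_tmul, wedgeTensor_tmul]
    rfl
  | add y z hy hz => simp only [map_add, hy, hz]

theorem covDer_wedgeTensor (i p : Fin N) (k : ℕ)
    (y : Localization.Away h ⊗[K] ⋀[K]^k (Fin N → K)) :
    covDer c (scalarField K _ b) i (wedgeTensor K h p k y) =
      wedgeTensor K h p k (covDer c (scalarField K _ b) i y) := by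
  induction y with
  | zero => simp
  | tmul f v => simp only [wedgeTensor_tmul, covDer_scalarField_tmul]
  | add y z hy hz => simp only [map_add, hy, hz]

theorem unitAction_wedge (q i p : Fin N) (k : ℕ) (v : ⋀[K]^k (Fin N → K)) :
    unitAction K (⋀[K]^(k + 1) (Fin N → K)) q i (wedge (Pi.single p (1 : K)) k v) =
      wedge (Pi.single p (1 : K)) k (unitAction K (⋀[K]^k (Fin N → K)) q i v) +
        if i = p then wedge (Pi.single q (1 : K)) k v else 0 := by
  have h1 : extDer (Matrix.toLin' (Matrix.single q i (1 : K)))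
      (ExteriorAlgebra.ι K (Pi.single p 1) * v.1) =
      ExteriorAlgebra.ι K (Pi.single p 1) *
          extDer (Matrix.toLin' (Matrix.single q i (1 : K))) v.1 +
        (Pi.single p (1 : K) : Fin N → K) i • ExteriorAlgebra.ι K (Pi.single q 1) * v.1 := by
    rw [extDer_mul, extDer_ι, toLin'_single_apply, map_smul]
  ext
  refine h1.trans ?_
  rw [Submodule.coe_add]
  congr 1
  rcases eq_or_ne i p with rfl | hip
  · rw [if_pos rfl, Pi.single_eq_same, one_smul]
    rfl
  · rw [if_neg hip, Pi.single_eq_of_ne hip, zero_smul, zero_mul]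
    rfl

theorem wedge_unitAction_antisymm (p q i : Fin N) (k : ℕ) (v : ⋀[K]^k (Fin N → K)) :
    wedge (Pi.single p (1 : K)) k (unitAction K (⋀[K]^k (Fin N → K)) q i v) =
      -wedge (Pi.single q (1 : K)) k (unitAction K (⋀[K]^k (Fin N → K)) p i v) := by
  have h1 : ∀ a b : Fin N, ((wedge (Pi.single a (1 : K)) k
      (unitAction K (⋀[K]^k (Fin N → K)) b i v) : ⋀[K]^(k + 1) (Fin N → K)) :
        ExteriorAlgebra K (Fin N → K)) = ExteriorAlgebra.ι K (Pi.single a 1) *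
        (ExteriorAlgebra.ι K (Pi.single b 1) *
          CliffordAlgebra.contractLeft (LinearMap.proj i) v.1) := fun a b =>
    congrArg (ExteriorAlgebra.ι K (Pi.single a 1) * ·) (extDer_single (K := K) b i v.1)
  ext
  rw [Submodule.coe_neg, h1, h1, ← mul_assoc, ← mul_assoc, ← neg_mul]
  congr 1
  exact eq_neg_of_add_eq_zero_left (ExteriorAlgebra.ι_add_mul_swap _ _)

theorem unitTensor_wedgeTensor (q i p : Fin N) (k : ℕ)
    (y : Localization.Away h ⊗[K] ⋀[K]^k (Fin N → K)) :
    unitTensor h _ q i (wedgeTensor K h p k y) =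
      wedgeTensor K h p k (unitTensor h _ q i y) +
        if i = p then wedgeTensor K h q k y else 0 := by
  induction y with
  | zero => simp
  | tmul f v =>
    simp only [wedgeTensor_tmul, unitTensor_tmul, unitAction_wedge, TensorProduct.tmul_add]
    split_ifs <;> simp
  | add y z hy hz =>
    simp only [map_add, hy, hz]
    split_ifs
    · abel
    · simp

theorem wedgeTensor_unitTensor_antisymm (p q i : Fin N) (k : ℕ)
    (y : Localization.Away h ⊗[K] ⋀[K]^k (Fin N → K)) :
    wedgeTensor K h p k (unitTensor h _ q i y) = -wedgeTensor K h q k (unitTensor h _ p i y) := by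
  induction y with
  | zero => simp
  | tmul f v =>
    simp only [wedgeTensor_tmul, unitTensor_tmul, wedge_unitAction_antisymm p q,
      TensorProduct.tmul_neg]
  | add y z hy hz => simp only [map_add, hy, hz, neg_add]

theorem gradOp_wedgeTensor (i p : Fin N) (f : Localization.Away h) (k : ℕ)
    (y : Localization.Away h ⊗[K] ⋀[K]^k (Fin N → K)) :
    gradOp c _ i f (wedgeTensor K h p k y) = wedgeTensor K h p k (gradOp c _ i f y) +
      if i = p then ∑ q, c.der q f • wedgeTensor K h q k y else 0 := by
  simp only [gradOp_apply, unitTensor_wedgeTensor, smul_add, Finset.sum_add_distrib, map_sum,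
    map_smul]
  split_ifs <;> simp

variable [CharZero K] (hc : ∀ i j f, c.der i (c.der j f) = c.der j (c.der i f))
include hc

/-- The Hessian of `f` is symmetric and `e_p ∧ E_{qi}` is antisymmetric in `p` and `q`. -/
theorem sum_wedgeTensor_gradOp (i : Fin N) (f : Localization.Away h) (k : ℕ)
    (y : Localization.Away h ⊗[K] ⋀[K]^k (Fin N → K)) :
    ∑ p, wedgeTensor K h p k (gradOp c _ i (c.der p f) y) = 0 := by
  simp only [gradOp_apply, map_sum, map_smul]
  set s := ∑ p, ∑ q, c.der q (c.der p f) • wedgeTensor K h p k (unitTensor h _ q i y) with hs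
  have h1 : s = -s := by
    conv_lhs => rw [hs, Finset.sum_comm]
    rw [hs, ← Finset.sum_neg_distrib]
    refine Finset.sum_congr rfl fun p _ => ?_
    rw [← Finset.sum_neg_distrib]
    refine Finset.sum_congr rfl fun q _ => ?_
    rw [hc, wedgeTensor_unitTensor_antisymm, smul_neg]
  refine eq_of_add_self_eq K ?_
  rw [add_zero]
  exact eq_neg_iff_add_eq_zero.mp h1

/-- The twisted de Rham differential commutes with the action of vector fields, like the exterior
derivative of differential forms with Lie derivatives. -/
theorem deRham_fieldOp {k : ℕ}
    (hB : IsGaugeField c (inflate K N (⋀[K]^k (Fin N → K))) (scalarField K _ b)) (i : Fin N)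
    (f : Localization.Away h) (y : Localization.Away h ⊗[K] ⋀[K]^k (Fin N → K)) :
    deRham c b k (fieldOp c (scalarField K _ b) i f y) =
      fieldOp c (scalarField K _ b) i f (deRham c b k y) := by
  simp only [deRham_apply, fieldOp_apply, map_add, covDer_smul, covDer_gradOp c hc hB, map_smul,
    map_sum, Finset.sum_add_distrib, sum_wedgeTensor_gradOp c hc, zero_add, covDer_wedgeTensor,
    gradOp_wedgeTensor, Finset.sum_ite_eq, Finset.mem_univ, if_true,
    covDer_comm c hB i]
  abel

theorem deRham_gaugeAction {k : ℕ}
    (hB : IsGaugeField c (inflate K N (⋀[K]^k (Fin N → K))) (scalarField K _ b))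
    (η : Derivation K A A) (y : Localization.Away h ⊗[K] ⋀[K]^k (Fin N → K)) :
    deRham c b k (gaugeAction c (inflate K N _) (scalarField K _ b) η y) =
      gaugeAction c (inflate K N _) (scalarField K _ b) η (deRham c b k y) := by
  simp only [gaugeAction_inflate, map_sum, deRham_fieldOp c b hc hB]

end DeRham

/-! ### Modules over vector fields built from scalar gauge fields -/

section Modules

variable {K : Type u} [Field K] {A : Type v} [CommRing A] [Algebra K A] {h : A} {N : ℕ}
  (c : ChartParameters K h N) {U : Type w} [AddCommGroup U] [Module K U]

/-- Multiplications by functions `b_i` are gauge fields when `∑ b_i dt_i` is closed. -/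
theorem isGaugeField_scalarField (hc : ∀ i j f, c.der i (c.der j f) = c.der j (c.der i f))
    {b : Fin N → Localization.Away h} (hb : ∀ i j, c.der i (b j) = c.der j (b i))
    (ρ : LPlus K N →ₗ⁅K⁆ Module.End K U) : IsGaugeField c ρ (scalarField K U b) where
  commute_rho i x y := by
    induction y with
    | zero => simp
    | tmul f u => rfl
    | add y z hy hz => simp only [map_add, hy, hz]
  flat i j := by
    refine LinearMap.ext fun y => ?_
    change covDer c (scalarField K U b) i (covDer c (scalarField K U b) j y) -
      covDer c (scalarField K U b) j (covDer c (scalarField K U b) i y) = 0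
    rw [sub_eq_zero]
    induction y with
    | zero => simp
    | tmul f u =>
      simp only [covDer_scalarField_tmul, map_add, Derivation.leibniz, hc i j, hb i j, smul_eq_mul]
      congr 1
      ring
    | add y z hy hz => simp only [map_add, hy, hz]

variable [LieRingModule (Matrix (Fin N) (Fin N) K) U] [LieModule K (Matrix (Fin N) (Fin N) K) U]
  {B : Fin N → Module.End (Localization.Away h) (Localization.Away h ⊗[K] U)}

theorem fieldOp_smul_left (i : Fin N) (r : K) (f : Localization.Away h)
    (y : Localization.Away h ⊗[K] U) :
    fieldOp c B i (r • f) y = r • fieldOp c B i f y := by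
  simp only [fieldOp_apply, gradOp_apply, Derivation.map_smul, smul_assoc, smul_add,
    Finset.smul_sum]

/-- The representation of `Der A` on `A_(h) ⊗ U` given by gauge fields, for a chart in which the
derivations of `A` are the vector fields `∑ η(t_i) ∂/∂t_i`. -/
noncomputable abbrev gaugeLieRingModule
    (hc : ∀ i j f, c.der i (c.der j f) = c.der j (c.der i f))
    (hη : ∀ (η : Derivation K A A) (x : A), algebraMap A (Localization.Away h) (η x) =
      ∑ i, algebraMap A (Localization.Away h) (η (c.t i)) *
        c.der i (algebraMap A (Localization.Away h) x))
    (hB : IsGaugeField c (inflate K N U) B) :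
    LieRingModule (Derivation K A A) (Localization.Away h ⊗[K] U) where
  bracket η y := gaugeAction c (inflate K N U) B η y
  add_lie η μ y := by
    change gaugeAction c (inflate K N U) B (η + μ) y = gaugeAction c (inflate K N U) B η y +
      gaugeAction c (inflate K N U) B μ y
    simp only [gaugeAction_inflate, Derivation.add_apply, map_add, fieldOp_add,
      Finset.sum_add_distrib]
  lie_add η y z := map_add _ y z
  leibniz_lie η μ y :=
    sub_eq_iff_eq_add.mp (gaugeAction_lie c hc hB η μ (hη η) (hη μ) y).symm

theorem gaugeAction_smul_left (r : K) (η : Derivation K A A) (y : Localization.Away h ⊗[K] U) :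
    gaugeAction c (inflate K N U) B (r • η) y = r • gaugeAction c (inflate K N U) B η y := by
  simp only [gaugeAction_inflate, Derivation.smul_apply, Finset.smul_sum,
    ← fieldOp_smul_left]
  refine Finset.sum_congr rfl fun i _ => ?_
  congr 2
  rw [Algebra.smul_def, map_mul, ← IsScalarTower.algebraMap_apply, Algebra.smul_def]

/-- Compatibility of the actions of functions and vector fields. -/
theorem gaugeAction_smul_right {η : Derivation K A A} {a : A}
    (hη : algebraMap A (Localization.Away h) (η a) =
      ∑ i, algebraMap A (Localization.Away h) (η (c.t i)) *
        c.der i (algebraMap A (Localization.Away h) a)) (y : Localization.Away h ⊗[K] U) :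
    gaugeAction c (inflate K N U) B η (a • y) =
      η a • y + a • gaugeAction c (inflate K N U) B η y := by
  have h1 : ∀ (a : A) (z : Localization.Away h ⊗[K] U),
      a • z = algebraMap A (Localization.Away h) a • z := fun a z =>
    (algebraMap_smul (Localization.Away h) a z).symm
  simp only [h1, gaugeAction_inflate, fieldOp_smul, Finset.sum_add_distrib, hη, Finset.sum_smul,
    Finset.smul_sum]
  exact add_comm _ _

section Transport

variable {U' : Type*} [AddCommGroup U'] [Module K U']
  [LieRingModule (Matrix (Fin N) (Fin N) K) U'] [LieModule K (Matrix (Fin N) (Fin N) K) U']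

/-- Tensor modules with scalar gauge fields are functorial in the `gl_N`-module. -/
theorem gaugeAction_baseChange (φ : U →ₗ⁅K, Matrix (Fin N) (Fin N) K⁆ U')
    (b : Fin N → Localization.Away h) (η : Derivation K A A) (y : Localization.Away h ⊗[K] U) :
    gaugeAction c (inflate K N U') (scalarField K U' b) η
        ((φ : U →ₗ[K] U').baseChange (Localization.Away h) y) =
      (φ : U →ₗ[K] U').baseChange (Localization.Away h)
        (gaugeAction c (inflate K N U) (scalarField K U b) η y) := by
  induction y with
  | zero => simp
  | tmul f u =>
    simp only [gaugeAction_inflate, fieldOp_apply, gradOp_apply, map_sum, map_add, map_smul,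
      LinearMap.baseChange_tmul, covDer_scalarField_tmul, unitTensor_tmul, unitAction_apply]
    simp
  | add y z hy hz => simp only [map_add, hy, hz]

end Transport

variable (K N U) in
/-- Every finite-dimensional `gl_N`-module is isomorphic to one with underlying space `K^d`. -/
theorem exists_equiv_fin [FiniteDimensional K U] :
    ∃ (d : ℕ) (_ : LieRingModule (Matrix (Fin N) (Fin N) K) (Fin d → K))
      (_ : LieModule K (Matrix (Fin N) (Fin N) K) (Fin d → K)),
      Nonempty (U ≃ₗ⁅K, Matrix (Fin N) (Fin N) K⁆ (Fin d → K)) := by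
  let φ : U ≃ₗ[K] (Fin (Module.finrank K U) → K) := (Module.finBasis K U).equivFun
  let I : LieRingModule (Matrix (Fin N) (Fin N) K) (Fin (Module.finrank K U) → K) :=
    { bracket := fun x w => φ ⁅x, φ.symm w⁆
      add_lie := fun x y w => by
        change φ ⁅x + y, φ.symm w⁆ = φ ⁅x, φ.symm w⁆ + φ ⁅y, φ.symm w⁆
        rw [add_lie, map_add]
      lie_add := fun x w z => by
        change φ ⁅x, φ.symm (w + z)⁆ = φ ⁅x, φ.symm w⁆ + φ ⁅x, φ.symm z⁆
        rw [map_add, lie_add, map_add]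
      leibniz_lie := fun x y w => by
        change φ ⁅x, φ.symm (φ ⁅y, φ.symm w⁆)⁆ =
          φ ⁅⁅x, y⁆, φ.symm w⁆ + φ ⁅y, φ.symm (φ ⁅x, φ.symm w⁆)⁆
        rw [φ.symm_apply_apply, φ.symm_apply_apply, leibniz_lie, map_add] }
  have J : LieModule K (Matrix (Fin N) (Fin N) K) (Fin (Module.finrank K U) → K) :=
    { smul_lie := fun r x w => by
        change φ ⁅r • x, φ.symm w⁆ = r • φ ⁅x, φ.symm w⁆
        rw [smul_lie, map_smul]
      lie_smul := fun r x w => by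
        change φ ⁅x, φ.symm (r • w)⁆ = r • φ ⁅x, φ.symm w⁆
        rw [map_smul, lie_smul, map_smul] }
  refine ⟨_, I, J, ⟨{ φ with map_lie' := ?_ }⟩⟩
  intro x u
  change φ ⁅x, u⁆ = φ ⁅x, φ.symm (φ u)⁆
  rw [φ.symm_apply_apply]

end Modules

/-! ### The standard chart of affine space -/

section AffineChart

variable (K : Type u) [Field K] (N : ℕ)

theorem bijective_mk_affineSpace :
    Function.Bijective (Ideal.Quotient.mk (Ideal.span (Set.range (affineSpace K N)))) := by
  refine ⟨?_, Ideal.Quotient.mk_surjective⟩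
  rw [RingHom.injective_iff_ker_eq_bot, Ideal.mk_ker, Set.range_eq_empty, Ideal.span_empty]

theorem bijective_algebraMap_one {A : Type v} [CommRing A] :
    Function.Bijective (algebraMap A (Localization.Away (1 : A))) :=
  (IsLocalization.atOne A (Localization.Away (1 : A))).bijective

instance {K : Type u} [Field K] {A : Type v} [CommRing A] [Algebra K A] {U : Type w}
    [AddCommGroup U] [Module K U] [FiniteDimensional K U] :
    Module.Finite A (Localization.Away (1 : A) ⊗[K] U) := by
  have h1 : Module.Finite A (Localization.Away (1 : A)) :=
    Module.Finite.of_surjective (Algebra.linearMap _ _) bijective_algebraMap_one.2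
  exact Module.Finite.trans (Localization.Away (1 : A)) _

/-- The functions on affine `N`-space are the polynomials in `N` variables. -/
noncomputable def affineEquiv : MvPolynomial (Fin N) K ≃ₐ[K]
    Localization.Away (1 : CoordRing (affineSpace K N)) :=
  AlgEquiv.ofBijective
    ((IsScalarTower.toAlgHom K (CoordRing (affineSpace K N)) (Localization.Away _)).comp
      (Ideal.Quotient.mkₐ K _))
    (bijective_algebraMap_one.comp (bijective_mk_affineSpace K N))

instance : Nontrivial (CoordRing (affineSpace K N)) :=
  (bijective_mk_affineSpace K N).1.nontrivial

/-- The coordinates of affine space as chart parameters. -/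
noncomputable def affineChart : ChartParameters K (1 : CoordRing (affineSpace K N)) N where
  t i := Ideal.Quotient.mk _ (MvPolynomial.X i)
  algebraicIndependent := by
    have h1 : MvPolynomial.aeval (fun i => Ideal.Quotient.mk
        (Ideal.span (Set.range (affineSpace K N))) (MvPolynomial.X i)) =
        Ideal.Quotient.mkₐ K (Ideal.span (Set.range (affineSpace K N))) :=
      MvPolynomial.algHom_ext fun i => by rw [MvPolynomial.aeval_X]; rfl
    rw [AlgebraicIndependent, h1]
    exact (bijective_mk_affineSpace K N).1
  isAlgebraic := by
    refine ⟨fun x => ?_⟩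
    have hx : x ∈ Algebra.adjoin K (Set.range fun i => Ideal.Quotient.mk
        (Ideal.span (Set.range (affineSpace K N))) (MvPolynomial.X i)) := by
      obtain ⟨P, rfl⟩ := Ideal.Quotient.mk_surjective x
      have h1 : Ideal.Quotient.mkₐ K (Ideal.span (Set.range (affineSpace K N))) P ∈
          (Algebra.adjoin K (Set.range MvPolynomial.X)).map
            (Ideal.Quotient.mkₐ K (Ideal.span (Set.range (affineSpace K N)))) := by
        rw [MvPolynomial.adjoin_range_X]
        exact ⟨P, trivial, rfl⟩
      rw [AlgHom.map_adjoin, ← Set.range_comp] at h1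
      exact h1
    exact isAlgebraic_algebraMap (⟨x, hx⟩ : Algebra.adjoin K (Set.range fun i => Ideal.Quotient.mk
        (Ideal.span (Set.range (affineSpace K N))) (MvPolynomial.X i)))
  der i := Derivation.mk' ((affineEquiv K N).toLinearMap ∘ₗ
      (MvPolynomial.pderiv i : Derivation K (MvPolynomial (Fin N) K) _).toLinearMap ∘ₗ
        (affineEquiv K N).symm.toLinearMap) fun a b => by
    simp
  der_t i j := by
    change affineEquiv K N (MvPolynomial.pderiv i ((affineEquiv K N).symm
      (affineEquiv K N (MvPolynomial.X j)))) = _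
    rw [AlgEquiv.symm_apply_apply, MvPolynomial.pderiv_X, Pi.single_apply]
    split_ifs <;> simp_all

variable {K N}

theorem der_affineEquiv (i : Fin N) (P : MvPolynomial (Fin N) K) :
    (affineChart K N).der i (affineEquiv K N P) = affineEquiv K N (MvPolynomial.pderiv i P) := by
  change affineEquiv K N (MvPolynomial.pderiv i ((affineEquiv K N).symm
      (affineEquiv K N P))) = _
  rw [AlgEquiv.symm_apply_apply]

theorem algebraMap_affineChart_t (i : Fin N) :
    algebraMap _ (Localization.Away (1 : CoordRing (affineSpace K N))) ((affineChart K N).t i) =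
      affineEquiv K N (MvPolynomial.X i) :=
  rfl

theorem affineChart_der_comm (i j : Fin N)
    (f : Localization.Away (1 : CoordRing (affineSpace K N))) :
    (affineChart K N).der i ((affineChart K N).der j f) =
      (affineChart K N).der j ((affineChart K N).der i f) := by
  obtain ⟨P, rfl⟩ := (affineEquiv K N).surjective f
  simp only [der_affineEquiv]
  congr 1
  have h1 : ⁅MvPolynomial.pderiv (R := K) i, MvPolynomial.pderiv (R := K) j⁆ = 0 := by
    refine MvPolynomial.derivation_ext fun l => ?_
    simp only [Derivation.commutator_apply, MvPolynomial.pderiv_X, Pi.single_apply]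
    split_ifs <;> simp
  have h2 := congrArg (fun D => D P) h1
  exact sub_eq_zero.mp h2

/-- On affine space every vector field is a combination of the coordinate fields. -/
theorem affineChart_expand
    (η : Derivation K (CoordRing (affineSpace K N)) (CoordRing (affineSpace K N)))
    (x : CoordRing (affineSpace K N)) :
    algebraMap _ (Localization.Away (1 : CoordRing (affineSpace K N))) (η x) =
      ∑ i, algebraMap _ _ (η ((affineChart K N).t i)) *
        (affineChart K N).der i (algebraMap _ _ x) := by
  obtain ⟨P, rfl⟩ := Ideal.Quotient.mk_surjective x
  induction P using MvPolynomial.induction_on with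
  | C a =>
    have h1 : Ideal.Quotient.mk (Ideal.span (Set.range (affineSpace K N))) (MvPolynomial.C a) =
        algebraMap K _ a := rfl
    simp only [h1, ← IsScalarTower.algebraMap_apply, Derivation.map_algebraMap]
    simp
  | add P Q hP hQ => simp only [map_add, hP, hQ, mul_add, Finset.sum_add_distrib]
  | mul_X P j hP =>
    have h1 : Ideal.Quotient.mk (Ideal.span (Set.range (affineSpace K N))) (MvPolynomial.X j) =
        (affineChart K N).t j := rfl
    simp only [map_mul, map_add, h1, Derivation.leibniz, smul_eq_mul, hP, ChartParameters.der_t,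
      mul_add, Finset.sum_add_distrib, Finset.mul_sum]
    congr 1
    · rw [Finset.sum_eq_single j]
      · rw [if_pos rfl, mul_one, mul_comm]
      · intro i _ hij
        rw [if_neg hij, mul_zero, mul_zero]
      · exact fun hj => absurd (Finset.mem_univ j) hj
    · exact Finset.sum_congr rfl fun i _ => mul_left_comm _ _ _

end AffineChart

/-! ### Reducible gauge modules on affine space -/

section AffineModules

variable {K : Type u} [Field K] {N : ℕ}

theorem isLocalGaugeModule_of_equiv {A : Type v} [CommRing A] [Algebra K A] {h : A}
    (c : ChartParameters K h N) {U : Type w} [AddCommGroup U] [Module K U]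
    [LieRingModule (Matrix (Fin N) (Fin N) K) U] [LieModule K (Matrix (Fin N) (Fin N) K) U]
    {U' : Type*} [AddCommGroup U'] [Module K U'] [LieRingModule (Matrix (Fin N) (Fin N) K) U']
    [LieModule K (Matrix (Fin N) (Fin N) K) U'] (φ : U ≃ₗ⁅K, Matrix (Fin N) (Fin N) K⁆ U')
    {b : Fin N → Localization.Away h} [Module.Finite A (Localization.Away h ⊗[K] U)]
    [LieRingModule (Derivation K A A) (Localization.Away h ⊗[K] U)]
    (hact : ∀ (η : Derivation K A A) (w : Localization.Away h ⊗[K] U),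
      ⁅η, w⁆ = gaugeAction c (inflate K N U) (scalarField K U b) η w) :
    IsLocalGaugeModule c (inflate K N U') (scalarField K U' b) (Localization.Away h ⊗[K] U) := by
  refine ⟨inferInstance, ((φ.toLinearEquiv : U →ₗ[K] U').baseChange
    (Localization.Away h)).restrictScalars A,
    (φ.toLinearEquiv.baseChange K (Localization.Away h) U U').injective, fun η w => ?_⟩
  rw [hact]
  exact (gaugeAction_baseChange c φ.toLieModuleHom b η w).symm

/-- The defining property of gauge modules in a chart `h = 1` that is not literally given by the
element `1`. -/
theorem exists_isLocalGaugeModule {A : Type v} [CommRing A] [Algebra K A]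
    (c : ChartParameters K (1 : A) N) {U : Type w} [AddCommGroup U] [Module K U]
    [FiniteDimensional K U]
    [LieRingModule (Matrix (Fin N) (Fin N) K) U] [LieModule K (Matrix (Fin N) (Fin N) K) U]
    (hc : ∀ i j f, c.der i (c.der j f) = c.der j (c.der i f))
    {b : Fin N → Localization.Away (1 : A)} (hb : ∀ i j, c.der i (b j) = c.der j (b i))
    [LieRingModule (Derivation K A A) (Localization.Away (1 : A) ⊗[K] U)]
    (hact : ∀ (η : Derivation K A A) (w : Localization.Away (1 : A) ⊗[K] U),
      ⁅η, w⁆ = gaugeAction c (inflate K N U) (scalarField K U b) η w) (h : A) (hh : h = 1) :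
    ∃ (c : ChartParameters K h N) (d : ℕ) (ρ : LPlus K N →ₗ⁅K⁆ Module.End K (Fin d → K))
      (B : Fin N → Module.End (Localization.Away h) (Localization.Away h ⊗[K] (Fin d → K))),
      IsGaugeField c ρ B ∧ IsLocalGaugeModule c ρ B (Localization.Away (1 : A) ⊗[K] U) := by
  subst hh
  obtain ⟨d, I, J, ⟨φ⟩⟩ := exists_equiv_fin K N U
  exact ⟨c, d, inflate K N _, scalarField K _ b, isGaugeField_scalarField c hc hb _,
    isLocalGaugeModule_of_equiv c φ hact⟩

theorem isGaugeModule_affineSpace {k : ℕ}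
    {b : Fin N → Localization.Away (1 : CoordRing (affineSpace K N))}
    [LieRingModule (Derivation K (CoordRing (affineSpace K N)) (CoordRing (affineSpace K N)))
      (Localization.Away (1 : CoordRing (affineSpace K N)) ⊗[K] ⋀[K]^k (Fin N → K))]
    (hb : ∀ i j, (affineChart K N).der i (b j) = (affineChart K N).der j (b i))
    (hact : ∀ (η : Derivation K (CoordRing (affineSpace K N)) (CoordRing (affineSpace K N)))
      (w : Localization.Away (1 : CoordRing (affineSpace K N)) ⊗[K] ⋀[K]^k (Fin N → K)),
      ⁅η, w⁆ = gaugeAction (affineChart K N) (inflate K N (⋀[K]^k (Fin N → K)))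
        (scalarField K _ b) η w) :
    IsGaugeModule (affineSpace K N) N
      (Localization.Away (1 : CoordRing (affineSpace K N)) ⊗[K] ⋀[K]^k (Fin N → K)) := by
  refine ⟨fun η f w => ?_, fun r rows cols hr _ => ?_⟩
  · rw [hact, hact, gaugeAction_smul_right _ (affineChart_expand η f)]
  · obtain rfl : r = 0 := by omega
    exact exists_isLocalGaugeModule (affineChart K N) affineChart_der_comm hb hact _
      Matrix.det_isEmpty

theorem isReducibleGaugeModule_affineChart {k : ℕ}
    {b : Fin N → Localization.Away (1 : CoordRing (affineSpace K N))}
    (hb : ∀ i j, (affineChart K N).der i (b j) = (affineChart K N).der j (b i))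
    {W : Submodule K
      (Localization.Away (1 : CoordRing (affineSpace K N)) ⊗[K] ⋀[K]^k (Fin N → K))}
    (hW : ∀ η, ∀ w ∈ W, gaugeAction (affineChart K N) (inflate K N (⋀[K]^k (Fin N → K)))
        (scalarField K _ b) η w ∈ W) (hbot : W ≠ ⊥) (htop : W ≠ ⊤) :
    IsReducibleGaugeModule (affineChart K N) b k W := by
  have hB := isGaugeField_scalarField (affineChart K N) affineChart_der_comm hb
    (inflate K N (⋀[K]^k (Fin N → K)))
  let I := gaugeLieRingModule (affineChart K N) affineChart_der_comm affineChart_expand hB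
  have J : LieModule K
      (Derivation K (CoordRing (affineSpace K N)) (CoordRing (affineSpace K N)))
      (Localization.Away (1 : CoordRing (affineSpace K N)) ⊗[K] ⋀[K]^k (Fin N → K)) :=
    { smul_lie := fun r η w => gaugeAction_smul_left (affineChart K N) r η w
      lie_smul := fun r η w => map_smul (gaugeAction (affineChart K N) (inflate K N _) _ η) r w }
  let S : LieSubmodule K
      (Derivation K (CoordRing (affineSpace K N)) (CoordRing (affineSpace K N)))
      (Localization.Away (1 : CoordRing (affineSpace K N)) ⊗[K] ⋀[K]^k (Fin N → K)) :=
    { W with lie_mem := fun {η w} hw => hW η w hw }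
  have hSbot : S ≠ ⊥ := fun h => hbot (congrArg LieSubmodule.toSubmodule h)
  have hStop : S ≠ ⊤ := fun h => htop (congrArg LieSubmodule.toSubmodule h)
  refine ⟨hB, I, J, fun η w => rfl, isGaugeModule_affineSpace hb fun η w => rfl, fun hirr => ?_,
    S, rfl, hSbot, hStop⟩
  exact (eq_bot_or_eq_top S).elim hSbot hStop

end AffineModules

/-! ### Kernels and images of the twisted de Rham differential -/

section KerRange

variable {K : Type u} [Field K] {N : ℕ}

/-- Contraction of the first factor of a tensor product by a functional. -/
noncomputable def contract {R : Type v} [CommRing R] [Algebra K R] {U : Type w} [AddCommGroup U]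
    [Module K U] (θ : R →ₗ[K] K) : R ⊗[K] U →ₗ[K] U :=
  (TensorProduct.lid K U : K ⊗[K] U →ₗ[K] U) ∘ₗ LinearMap.rTensor U θ

theorem contract_tmul {R : Type v} [CommRing R] [Algebra K R] {U : Type w} [AddCommGroup U]
    [Module K U] (θ : R →ₗ[K] K) (f : R) (u : U) : contract θ (f ⊗ₜ[K] u) = θ f • u := by
  simp [contract]

theorem exists_exteriorPower_ne_zero {k : ℕ} (hk : k ≤ N) : ∃ v : ⋀[K]^k (Fin N → K), v ≠ 0 := by
  have h1 : 0 < Module.finrank K (⋀[K]^k (Fin N → K)) := by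
    rw [exteriorPower.finrank_eq, Module.finrank_fin_fun]
    exact Nat.choose_pos hk
  have := Module.nontrivial_of_finrank_pos h1
  exact exists_ne 0

theorem exists_wedge_ne_zero {k : ℕ} (hk : k < N) :
    ∃ (p : Fin N) (v : ⋀[K]^k (Fin N → K)), wedge (Pi.single p (1 : K)) k v ≠ 0 := by
  by_contra! hzero
  have h1 : ∀ x : Fin N → K, ∀ v ∈ ⋀[K]^k (Fin N → K), ExteriorAlgebra.ι K x * v = 0 := by
    intro x v hv
    have h2 : LinearMap.mulRight K v ∘ₗ ExteriorAlgebra.ι K (M := Fin N → K) = 0 := by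
      refine (Pi.basisFun K (Fin N)).ext fun p => ?_
      rw [Pi.basisFun_apply]
      exact congrArg Subtype.val (hzero p ⟨v, hv⟩)
    exact LinearMap.congr_fun h2 x
  obtain ⟨w, hw⟩ := exists_exteriorPower_ne_zero (K := K) hk
  refine hw (Subtype.ext ?_)
  have h3 : ⋀[K]^(k + 1) (Fin N → K) ≤ ⊥ := by
    rw [ExteriorAlgebra.exteriorPower, pow_succ', Submodule.mul_le]
    rintro _ ⟨x, rfl⟩ v hv
    exact (Submodule.mem_bot K).mpr (h1 x v hv)
  exact (Submodule.mem_bot K).mp (h3 w.2)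

/-- A multiple of the moments `∫ x^n exp (-x^2) dx` of the Gaussian density. -/
def gaussMoment (K : Type u) [Field K] : ℕ → K
  | 0 => 1
  | 1 => 0
  | n + 2 => (n + 1) / 2 * gaussMoment K n

theorem gaussMoment_succ [CharZero K] (n : ℕ) :
    (n : K) * gaussMoment K (n - 1) = 2 * gaussMoment K (n + 1) := by
  cases n with
  | zero => simp [gaussMoment]
  | succ n =>
    rw [Nat.add_sub_cancel, gaussMoment]
    push_cast
    field_simp

variable (K N) in
/-- Integration of polynomials against a multiple of the Gaussian density `exp (-∑ x_i^2)`. -/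
noncomputable def gaussIntegral : MvPolynomial (Fin N) K →ₗ[K] K :=
  (MvPolynomial.basisMonomials (Fin N) K).constr K fun m => ∏ i, gaussMoment K (m i)

theorem gaussIntegral_monomial (m : Fin N →₀ ℕ) (a : K) :
    gaussIntegral K N (MvPolynomial.monomial m a) = a * ∏ i, gaussMoment K (m i) := by
  have h1 : MvPolynomial.monomial m a = a • MvPolynomial.basisMonomials (Fin N) K m := by
    simp [MvPolynomial.smul_monomial]
  rw [h1, map_smul, gaussIntegral, Module.Basis.constr_basis, smul_eq_mul]

/-- Integration by parts. -/
theorem gaussIntegral_pderiv [CharZero K] (p : Fin N) (P : MvPolynomial (Fin N) K) :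
    gaussIntegral K N (MvPolynomial.pderiv p P) =
      2 * gaussIntegral K N (MvPolynomial.X p * P) := by
  induction P using MvPolynomial.induction_on' with
  | monomial m a =>
    have h1 : ∀ m' : Fin N →₀ ℕ, (∀ i, i ≠ p → m' i = m i) → ∏ i, gaussMoment K (m' i) =
        gaussMoment K (m' p) * ∏ i ∈ Finset.univ.erase p, gaussMoment K (m i) := by
      intro m' hm'
      rw [← Finset.mul_prod_erase _ _ (Finset.mem_univ p)]
      congr 1
      exact Finset.prod_congr rfl fun i hi => by rw [hm' i (Finset.ne_of_mem_erase hi)]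
    rw [MvPolynomial.pderiv_monomial, MvPolynomial.X, MvPolynomial.monomial_mul,
      gaussIntegral_monomial, gaussIntegral_monomial, h1, h1]
    · have h2 := gaussMoment_succ (K := K) (m p)
      simp only [Finsupp.tsub_apply, Finsupp.add_apply, Finsupp.single_eq_same, one_mul,
        add_comm 1 (m p)]
      linear_combination (a * ∏ i ∈ Finset.univ.erase p, gaussMoment K (m i)) * h2
    · intro i hi
      simp [Finsupp.single_eq_of_ne hi]
    · intro i hi
      simp [Finsupp.single_eq_of_ne hi]
  | add P Q hP hQ => simp only [map_add, mul_add, hP, hQ]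

theorem deRham_tmul {A : Type v} [CommRing A] [Algebra K A] {h : A} (c : ChartParameters K h N)
    (b : Fin N → Localization.Away h) (k : ℕ) (f : Localization.Away h)
    (v : ⋀[K]^k (Fin N → K)) :
    deRham c b k (f ⊗ₜ v) = ∑ p, (c.der p f + b p * f) ⊗ₜ wedge (Pi.single p (1 : K)) k v := by
  simp only [deRham_apply, covDer_scalarField_tmul, wedgeTensor_tmul]

/-- A functional on polynomials, as a functional on the functions of the standard chart. -/
noncomputable def affineFunctional (θ : MvPolynomial (Fin N) K →ₗ[K] K) :
    Localization.Away (1 : CoordRing (affineSpace K N)) →ₗ[K] K :=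
  θ ∘ₗ (affineEquiv K N).symm.toLinearMap

theorem affineFunctional_affineEquiv (θ : MvPolynomial (Fin N) K →ₗ[K] K)
    (P : MvPolynomial (Fin N) K) : affineFunctional θ (affineEquiv K N P) = θ P :=
  congrArg θ ((affineEquiv K N).symm_apply_apply P)

theorem affineFunctional_one (θ : MvPolynomial (Fin N) K →ₗ[K] K) :
    affineFunctional θ 1 = θ 1 := by
  rw [← affineFunctional_affineEquiv θ 1, map_one (affineEquiv K N)]

theorem ker_deRham_ne_bot {k : ℕ} (hk : k < N) :
    LinearMap.ker (deRham (affineChart K N) (fun _ => 0) k) ≠ ⊥ := by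
  obtain ⟨v, hv⟩ := exists_exteriorPower_ne_zero (K := K) hk.le
  intro h1
  have h2 : (1 : Localization.Away (1 : CoordRing (affineSpace K N))) ⊗ₜ[K] v ∈
      LinearMap.ker (deRham (affineChart K N) (fun _ => 0) k) := by
    rw [LinearMap.mem_ker, deRham_tmul]
    simp
  rw [h1, Submodule.mem_bot] at h2
  have h3 := congrArg
    (contract (affineFunctional (MvPolynomial.aeval fun _ : Fin N => (0 : K)).toLinearMap)) h2
  rw [contract_tmul, map_zero, affineFunctional_one, AlgHom.toLinearMap_apply, map_one,
    one_smul] at h3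
  exact hv h3

theorem ker_deRham_ne_top {k : ℕ} (hk : k < N) :
    LinearMap.ker (deRham (affineChart K N) (fun _ => 0) k) ≠ ⊤ := by
  obtain ⟨p, v, hv⟩ := exists_wedge_ne_zero (K := K) hk
  intro h1
  have h2 : affineEquiv K N (MvPolynomial.X p) ⊗ₜ[K] v ∈
      LinearMap.ker (deRham (affineChart K N) (fun _ => 0) k) := h1 ▸ Submodule.mem_top
  have h3 := congrArg
    (contract (affineFunctional (MvPolynomial.aeval fun _ : Fin N => (0 : K)).toLinearMap))
    (LinearMap.mem_ker.mp h2)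
  rw [deRham_tmul, map_sum, Finset.sum_eq_single p] at h3
  · rw [contract_tmul, zero_mul, add_zero, der_affineEquiv, affineFunctional_affineEquiv,
      MvPolynomial.pderiv_X_self, AlgHom.toLinearMap_apply, map_one, one_smul, map_zero] at h3
    exact hv h3
  · intro q _ hqp
    rw [contract_tmul, zero_mul, add_zero, der_affineEquiv, affineFunctional_affineEquiv,
      MvPolynomial.pderiv_X_of_ne hqp.symm, map_zero, zero_smul]
  · simp

theorem neg_two_mul_t (i : Fin N) :
    -2 * algebraMap _ (Localization.Away (1 : CoordRing (affineSpace K N)))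
      ((affineChart K N).t i) = affineEquiv K N ((-2 : K) • MvPolynomial.X i) := by
  rw [map_smul, algebraMap_affineChart_t, Algebra.smul_def, map_neg, map_ofNat]

/-- In the twisted complex, `d (1 ⊗ v) = -2 ∑ x_p ⊗ e_p ∧ v`. -/
theorem range_deRham_ne_bot [CharZero K] {k : ℕ} (hk : k < N) :
    LinearMap.range (deRham (affineChart K N)
      (fun i => -2 * algebraMap _ _ ((affineChart K N).t i)) k) ≠ ⊥ := by
  obtain ⟨p, v, hv⟩ := exists_wedge_ne_zero (K := K) hk
  intro h1
  have h2 := LinearMap.congr_fun (LinearMap.range_eq_bot.mp h1) (1 ⊗ₜ[K] v)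
  -- The functional takes the coefficient of `x_p`.
  have h3 := congrArg (contract (affineFunctional
    ((MvPolynomial.aeval fun _ : Fin N => (0 : K)).toLinearMap ∘ₗ
      (MvPolynomial.pderiv (R := K) p).toLinearMap))) h2
  have h4 : ∀ q, affineFunctional ((MvPolynomial.aeval fun _ : Fin N => (0 : K)).toLinearMap ∘ₗ
      (MvPolynomial.pderiv (R := K) p).toLinearMap) ((affineChart K N).der q 1 +
        -2 * algebraMap _ _ ((affineChart K N).t q) * 1) = if q = p then -2 else 0 := by
    intro q
    rw [Derivation.map_one_eq_zero, zero_add, mul_one, neg_two_mul_t,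
      affineFunctional_affineEquiv]
    rw [map_smul, LinearMap.comp_apply]
    change (-2 : K) • MvPolynomial.aeval (fun _ : Fin N => (0 : K))
      (MvPolynomial.pderiv p (MvPolynomial.X q)) = _
    rw [MvPolynomial.pderiv_X, Pi.single_apply]
    split_ifs <;> simp
  rw [deRham_tmul, map_sum, LinearMap.zero_apply, map_zero] at h3
  simp only [contract_tmul, h4, ite_smul, zero_smul, Finset.sum_ite_eq', Finset.mem_univ, if_true]
    at h3
  exact hv ((smul_eq_zero.mp h3).resolve_left (neg_ne_zero.mpr two_ne_zero))

/-- Exact forms in the twisted complex have integral zero against the Gaussian density. -/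
theorem range_deRham_ne_top [CharZero K] {k : ℕ} (hk : k < N) :
    LinearMap.range (deRham (affineChart K N)
      (fun i => -2 * algebraMap _ _ ((affineChart K N).t i)) k) ≠ ⊤ := by
  obtain ⟨w, hw⟩ := exists_exteriorPower_ne_zero (K := K) hk
  intro h1
  obtain ⟨y, hy⟩ := LinearMap.range_eq_top.mp h1 (1 ⊗ₜ[K] w)
  have h2 : ∀ y, contract (affineFunctional (gaussIntegral K N)) (deRham (affineChart K N)
      (fun i => -2 * algebraMap _ _ ((affineChart K N).t i)) k y) = 0 := by
    intro y
    induction y with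
    | zero => simp
    | tmul f v =>
      rw [deRham_tmul, map_sum]
      refine Finset.sum_eq_zero fun p _ => ?_
      obtain ⟨P, rfl⟩ := (affineEquiv K N).surjective f
      rw [contract_tmul, neg_two_mul_t, der_affineEquiv, ← map_mul, ← map_add,
        affineFunctional_affineEquiv, map_add, gaussIntegral_pderiv]
      rw [smul_mul_assoc, map_smul, smul_eq_mul, neg_mul, add_neg_cancel, zero_smul]
    | add y z hy hz => rw [map_add, map_add, hy, hz, add_zero]
  have h4 := h2 y
  have h5 : gaussIntegral K N 1 = 1 := by
    rw [← MvPolynomial.C_1, ← MvPolynomial.monomial_zero', gaussIntegral_monomial]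
    simp [gaussMoment]
  rw [hy, contract_tmul, affineFunctional_one, h5, one_smul] at h4
  exact hw h4

theorem isReducibleGaugeModule_ker {k : ℕ} [CharZero K] (hk : k < N) :
    IsReducibleGaugeModule (affineChart K N) (fun _ => 0) k
      (LinearMap.ker (deRham (affineChart K N) (fun _ => 0) k)) := by
  refine isReducibleGaugeModule_affineChart (fun i j => by simp) (fun η w hw => ?_)
    (ker_deRham_ne_bot hk) (ker_deRham_ne_top hk)
  rw [LinearMap.mem_ker, deRham_gaugeAction _ _ affineChart_der_comm
    (isGaugeField_scalarField _ affineChart_der_comm (fun i j => by simp) _),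
    LinearMap.mem_ker.mp hw, map_zero]

theorem isReducibleGaugeModule_range {k : ℕ} [CharZero K] (hk : k < N) :
    IsReducibleGaugeModule (affineChart K N)
      (fun i => -2 * algebraMap _ _ ((affineChart K N).t i)) (k + 1)
      (LinearMap.range (deRham (affineChart K N)
        (fun i => -2 * algebraMap _ _ ((affineChart K N).t i)) k)) := by
  have hb : ∀ i j : Fin N, (affineChart K N).der i
      (-2 * algebraMap _ _ ((affineChart K N).t j)) =
      (affineChart K N).der j (-2 * algebraMap _ _ ((affineChart K N).t i)) := by
    intro i j
    rw [neg_two_mul_t, neg_two_mul_t, der_affineEquiv, der_affineEquiv]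
    rw [Derivation.map_smul, Derivation.map_smul, MvPolynomial.pderiv_X, MvPolynomial.pderiv_X,
      Pi.single_apply, Pi.single_apply]
    simp only [eq_comm]
  refine isReducibleGaugeModule_affineChart hb ?_ (range_deRham_ne_bot hk)
    (range_deRham_ne_top hk)
  rintro η _ ⟨y, rfl⟩
  exact ⟨_, deRham_gaugeAction _ _ affineChart_der_comm
    (isGaugeField_scalarField _ affineChart_der_comm hb _) η y⟩

end KerRange

end Gauge

theorem theorem12 (K : Type u) [Field K] [IsAlgClosed K] [CharZero K] :
    (∀ (n m N r : ℕ) (g : Fin m → MvPolynomial (Fin n) K),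
      Gauge.IsSmoothIrreducible g N →
      ∀ (U : Type v) [AddCommGroup U] [Module K U] [FiniteDimensional K U]
        [LieRingModule (Matrix (Fin N) (Fin N) K) U]
        [LieModule K (Matrix (Fin N) (Fin N) K) U],
      LieModule.IsIrreducible K (Matrix (Fin N) (Fin N) K) U →
      (∀ k ≤ N, ¬ Nonempty (U ≃ₗ⁅K, Matrix (Fin N) (Fin N) K⁆ ⋀[K]^k (Fin N → K))) →
      ∀ (M : Type w) [AddCommGroup M] [Module K M] [Module (Gauge.CoordRing g) M]
        [IsScalarTower K (Gauge.CoordRing g) M]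
        [LieRingModule (Derivation K (Gauge.CoordRing g) (Gauge.CoordRing g)) M]
        [LieModule K (Derivation K (Gauge.CoordRing g) (Gauge.CoordRing g)) M] [Nontrivial M],
      Gauge.IsGaugeModule g N M →
      ∀ (rows : Fin r → Fin m) (cols : Fin r → Fin n), r + N = n →
      Gauge.jacobianMinor g rows cols ≠ 0 →
      ∀ (c : Gauge.ChartParameters K (Gauge.jacobianMinor g rows cols) N)
        (B : Fin N → Module.End (Localization.Away (Gauge.jacobianMinor g rows cols))
          (Localization.Away (Gauge.jacobianMinor g rows cols) ⊗[K] U)),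
      Gauge.IsGaugeField c (Gauge.inflate K N U) B →
      Gauge.IsLocalGaugeModule c (Gauge.inflate K N U) B M →
      LieModule.IsIrreducible K (Derivation K (Gauge.CoordRing g) (Gauge.CoordRing g)) M) ∧
    (∀ N : ℕ,
      ∃ c : Gauge.ChartParameters K (1 : Gauge.CoordRing (Gauge.affineSpace K N)) N,
        (∀ i, c.t i = Ideal.Quotient.mk (Ideal.span (Set.range (Gauge.affineSpace K N)))
          (MvPolynomial.X i)) ∧
        (∀ k < N, Gauge.IsReducibleGaugeModule c (fun _ => 0) k
          (LinearMap.ker (Gauge.deRham c (fun _ => 0) k))) ∧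
        (∀ k, k + 1 = N →
          Gauge.IsReducibleGaugeModule c (fun i => -2 * algebraMap _ _ (c.t i)) (k + 1)
            (LinearMap.range (Gauge.deRham c (fun i => -2 * algebraMap _ _ (c.t i)) k)))) := by
  refine ⟨fun n m N r g hg U _ _ _ _ _ hirr hU M _ _ _ _ _ _ _ hM rows cols _ hminor c B _
      hloc => ?_,
    fun N => ⟨Gauge.affineChart K N, fun _ => rfl,
      fun k hk => Gauge.isReducibleGaugeModule_ker hk,
      fun k hk => Gauge.isReducibleGaugeModule_range (by omega)⟩⟩
  exact Gauge.IsGaugeModule.isIrreducible hg hU hM hminor c B hloc
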